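/- Let $N\ge 1$ be an integer, $m\ge 0$, $p,q>1$, $R>0$ be real, and put $\xi(t)=\frac{t^{m+1}}{m+1}$. Let $p_{tr}(N,m)=1+\frac{2}{(m+1)(N-1)-m}$ (with $p_{tr}(1,0)=+\infty$), let $q_C(N,m)$ be the greatest real root of $$((m+1)N-1)\,q^2-((m+1)N+1-2m)\,q-2(m+1)=0,$$ and let $\Lambda(p,q,N,m)=(q-1)\big[(m+1)(N-1)p-m(p-2)-2\big]$. Assume that $$\Lambda(p,q,N,m)<4,\qquad p>p_{tr}(N,m),\qquad q>q_C(N,m).$$ Let $f,g\in C_0^\infty(\mathbb R^N)$ be non-negative functions supported in $\{|x|\le R\}$, neither of which vanishes identically. For $\varepsilon>0$ consider the Cauchy problem $$u_{tt}-t^{2m}\Delta u=|u_t|^p+|u|^q\ \text{ in }\mathbb R^N\times[0,\infty),\qquad u(x,0)=\varepsilon f(x),\quad u_t(x,0)=\varepsilon g(x).\qquad (*)$$ An energy solution of $(*)$ on $[0,T)$, $T\in(0,\infty]$, is a function $u\in C([0,T),H^1(\mathbb R^N))\cap C^1([0,T),L^2(\mathbb R^N))$ with $u\in L^q_{loc}((0,T)\times\mathbb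 R^N)$ and $u_t\in L^p_{loc}((0,T)\times\mathbb R^N)$, which takes the initial values in $(*)$ and satisfies, for all $\Phi\in C_0^\infty(\mathbb R^N\times[0,T))$ and all $t\in[0,T)$, $$\int_{\mathbb R^N}u_t(x,t)\Phi(x,t)\,dx-\int_{\mathbb R^N}u_t(x,0)\Phi(x,0)\,dx-\int_0^t\!\int_{\mathbb R^N}u_t\Phi_t\,dx\,ds+\int_0^t s^{2m}\!\int_{\mathbb R^N}\nabla u\cdot\nabla\Phi\,dx\,ds=\int_0^t\!\int_{\mathbb R^N}\{|u_t|^p+|u|^q\}\Phi\,dx\,ds,$$ where the integral on the right is required to converge. Then there exist constants $\varepsilon_0>0$ and $C>0$, depending only on $f,g,N,R,p,q,m$, such that for every $0<\varepsilon\le\varepsilon_0$: if $u$ is an energy solution of $(*)$ on $[0,T_\varepsilon)$, $T_\varepsilon\in(0,\infty]$, with $\operatorname{supp}u\subset\{(x,t)\in\mathbb R^N\times[0,\infty):|x|\le\xi(t)+R\}$, then $$T_\varepsilon\le C\,\varepsilon^{-\frac{2p(q-1)}{4-\Lambda(p,q,N,m)}}.$$ -/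

import Mathlib

open MeasureTheory Set
open scoped ENNReal ContDiff

noncomputable section

namespace Tricomi

/-- The Euclidean space `ℝ^N`. -/
abbrev Space (N : ℕ) := EuclideanSpace ℝ (Fin N)

/-- `L²(ℝ^N)`, real-valued. -/
abbrev L2 (N : ℕ) := Lp ℝ 2 (volume : Measure (Space N))

/-- `L²(ℝ^N; ℝ^N)`, vector fields. -/
abbrev L2Vec (N : ℕ) := Lp (Space N) 2 (volume : Measure (Space N))

/-- `w` is the weak (distributional) gradient of `v`. -/
def IsWeakGradient {N : ℕ} (v : L2 N) (w : L2Vec N) : Prop :=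
  ∀ φ : Space N → ℝ, ContDiff ℝ ∞ φ → HasCompactSupport φ → ∀ e : Space N,
    ∫ x, v x * fderiv ℝ φ x e = -∫ x, inner ℝ (w x) e * φ x

/-- The Sobolev space `H¹(ℝ^N)`: functions in `L²` together with their weak gradient in `L²`. The
subspace topology of `L² × L²` is the topology of the `H¹` norm. -/
abbrev H1 (N : ℕ) := {z : L2 N × L2Vec N // IsWeakGradient z.1 z.2}

/-- The underlying `L²` function of an element of `H¹`. -/
def H1.fn {N : ℕ} (z : H1 N) : L2 N := z.1.1

/-- The weak gradient of an element of `H¹`. -/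
def H1.grad {N : ℕ} (z : H1 N) : L2Vec N := z.1.2

/-- The time interval `[0, T)`, where `T ∈ [0, ∞]`. -/
def timeInterval (T : ℝ≥0∞) : Set ℝ := {t | 0 ≤ t ∧ ENNReal.ofReal t < T}

/-- The time derivative `u_t`, as an `L²`-valued function on `[0, T)` (one-sided at `t = 0`). -/
def timeDeriv {N : ℕ} (T : ℝ≥0∞) (u : ℝ → H1 N) (t : ℝ) : L2 N :=
  derivWithin (fun s => (u s).fn) (timeInterval T) t

/-- The family of functions `h t`, `0 < t < T`, seen as a function of `(x, t)`, belongs to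
`L^r_loc((0, T) × ℝ^N)`. -/
def MemLpLoc {N : ℕ} (r : ℝ) (T : ℝ≥0∞) (h : ℝ → L2 N) : Prop :=
  ∃ H : Space N × ℝ → ℝ,
    (∀ t : ℝ, 0 < t → ENNReal.ofReal t < T → (fun x => H (x, t)) =ᵐ[volume] h t) ∧
    ∀ K : Set (Space N × ℝ), IsCompact K →
      K ⊆ {z | 0 < z.2 ∧ ENNReal.ofReal z.2 < T} →
      MemLp H (ENNReal.ofReal r) (volume.restrict K)

/-- Test functions `Φ ∈ C_0^∞(ℝ^N × [0, T))`, as restrictions to `t ≥ 0` of smooth functions with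
compact support in `ℝ^N × (-∞, T)`. -/
structure IsTestFunction {N : ℕ} (T : ℝ≥0∞) (Φ : Space N × ℝ → ℝ) : Prop where
  smooth : ContDiff ℝ ∞ Φ
  compact_support : HasCompactSupport Φ
  support_lt : tsupport Φ ⊆ {z | ENNReal.ofReal z.2 < T}

/-- The spatial integral `∫ (|u_t(x,s)|^p + |u(x,s)|^q) Φ(x,s) dx`. -/
def nonlinearTerm {N : ℕ} (p q : ℝ) (T : ℝ≥0∞) (u : ℝ → H1 N) (Φ : Space N × ℝ → ℝ) (s : ℝ) : ℝ :=
  ∫ x, (|timeDeriv T u s x| ^ p + |(u s).fn x| ^ q) * Φ (x, s)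

/-- `u` is an energy solution on `[0, T)` of
`u_tt - t^{2m} Δu = |u_t|^p + |u|^q`, `u(x,0) = ε f(x)`, `u_t(x,0) = ε g(x)`. -/
structure IsEnergySolution {N : ℕ} (m p q ε : ℝ) (f g : Space N → ℝ) (T : ℝ≥0∞)
    (u : ℝ → H1 N) : Prop where
  /-- `u ∈ C([0,T), H¹)` -/
  continuous_H1 : ContinuousOn u (timeInterval T)
  /-- `u ∈ C¹([0,T), L²)` -/
  contDiff_L2 : ContDiffOn ℝ 1 (fun t => (u t).fn) (timeInterval T)
  memLpLoc_fn : MemLpLoc q T (fun t => (u t).fn)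
  memLpLoc_timeDeriv : MemLpLoc p T (timeDeriv T u)
  initial_fn : (u 0).fn =ᵐ[volume] fun x => ε * f x
  initial_timeDeriv : timeDeriv T u 0 =ᵐ[volume] fun x => ε * g x
  /-- the right-hand side of the weak formulation is a convergent integral -/
  nonlinear_integrable : ∀ Φ : Space N × ℝ → ℝ, IsTestFunction T Φ → ∀ t ∈ timeInterval T,
    IntervalIntegrable (nonlinearTerm p q T u Φ) volume 0 t
  /-- the weak formulation -/
  weak_form : ∀ Φ : Space N × ℝ → ℝ, IsTestFunction T Φ → ∀ t ∈ timeInterval T,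
    (∫ x, timeDeriv T u t x * Φ (x, t)) - (∫ x, timeDeriv T u 0 x * Φ (x, 0))
      - (∫ s in (0 : ℝ)..t, ∫ x, timeDeriv T u s x * deriv (fun τ => Φ (x, τ)) s)
      + (∫ s in (0 : ℝ)..t, s ^ (2 * m) *
          ∫ x, inner ℝ ((u s).grad x) (gradient (fun y => Φ (y, s)) x))
      = ∫ s in (0 : ℝ)..t, nonlinearTerm p q T u Φ s

/-- `ξ(t) = t^{m+1} / (m+1)`. -/
def xi (m t : ℝ) : ℝ := t ^ (m + 1) / (m + 1)

/-- `supp u ⊆ {(x, t) : |x| ≤ ξ(t) + R}`. -/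
def SupportedInCone {N : ℕ} (m R : ℝ) (T : ℝ≥0∞) (u : ℝ → H1 N) : Prop :=
  ∀ t ∈ timeInterval T, ∀ᵐ x : Space N, xi m t + R < ‖x‖ → (u t).fn x = 0

/-- `p_tr(N,m) = 1 + 2 / ((m+1)(N-1) - m)`, with `2 / 0 = ∞`. For `N ≥ 1` and `m ≥ 0` the
denominator vanishes only for `N = 1`, `m = 0`. -/
def pTr (N : ℕ) (m : ℝ) : EReal :=
  if (m + 1) * ((N : ℝ) - 1) - m = 0 then ⊤
  else ((1 + 2 / ((m + 1) * ((N : ℝ) - 1) - m) : ℝ) : EReal)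

/-- The quadratic polynomial whose greatest root is `q_C(N,m)`. -/
def quadTr (N : ℕ) (m q : ℝ) : ℝ :=
  ((m + 1) * N - 1) * q ^ 2 - ((m + 1) * N + 1 - 2 * m) * q - 2 * (m + 1)

/-- `q_C(N,m)`, the greatest root of the quadratic equation. -/
def qC (N : ℕ) (m : ℝ) : ℝ := sSup {q : ℝ | quadTr N m q = 0}

/-- `Λ(p,q,N,m) = (q-1) [(m+1)(N-1)p - m(p-2) - 2]`. -/
def lam (p q : ℝ) (N : ℕ) (m : ℝ) : ℝ :=
  (q - 1) * ((m + 1) * ((N : ℝ) - 1) * p - m * (p - 2) - 2)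

end Tricomi

end

/-!
The solution is tested only with functions that do not depend on time (up to a cutoff), so that
everything reduces to differential inequalities for two scalar functions of `t`. This avoids the
time-dependent adjoint solution `ρ(t) φ(x)`, `ρ'' = t^{2m} ρ`, which is not smooth at `t = 0` for
general `m`.

Let `φ` be the positive radial solution of `Δφ = φ` (`eigenfun`). Then `U = ∫ u φ dx` satisfies
`U'' ≥ t^{2m} U` and has positive data of size `ε`. Comparison with an explicit WKB subsolution
(`wkb`) gives `U' = ∫ u_t φ dx ≥ c ε t^{m/2} e^{ξ(t)}` for large `t` (`exists_exp_growth`). The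
power series of the radial profile of `φ` gives `φ(x) ≤ C (1 + |x|)^{-(N-1)/2} e^{|x|}`
(`exists_besselSeries_le`), hence the growth of the `L^{p'}` norm of `φ` over the light cone
`|x| ≤ ξ(t) + R` (`exists_dual_norm_le`), and by Hölder's inequality
`∫ |u_t|^p dx ≥ c ε^p t^β` with `β = mp/2 - (m+1)(N-1)(p/2-1)`.

On the other hand `F = ∫ u dx` satisfies `F'' = ∫ (|u_t|^p + |u|^q) dx =: n`, and Hölder's
inequality over the light cone gives `n ≥ c t^{-(m+1)N(q-1)} F^q`. These facts about `U` and `F` are collected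
in `IsEnergySolution.exists_scalar_reduction`. Integrating `F'' ≥ c ε^p t^β` twice gives
`F(τ) ≥ c ε^p τ^{β+2}`. Starting from this value at time `τ`, solutions of
`F'' ≥ c τ^{-(m+1)N(q-1)} F^q` blow up before the time `2τ` as soon as
`(ε^p τ^{β+2})^{q-1} τ^{2-(m+1)N(q-1)} = ε^{p(q-1)} τ^{(4-Λ)/2}` exceeds a constant
(`exists_blowup_const`, `exists_scalar_lifespan`). As `Λ < 4`, this holds for
`τ = D ε^{-2p(q-1)/(4-Λ)}` with `D` large. The cutoff `ε ≤ 1` ensures that `τ` lies in the range of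
times where the lower bound for `U'` holds.
-/

noncomputable section

namespace Tricomi

/-! ### Ordinary differential inequalities -/

theorem monotoneOn_of_hasDerivWithinAt_nonneg {a b : ℝ} {D E : ℝ → ℝ}
    (hD : ∀ t ∈ Icc a b, HasDerivWithinAt D (E t) (Icc a b) t)
    (hE : ∀ t ∈ Ioo a b, 0 ≤ E t) : MonotoneOn D (Icc a b) := by
  apply monotoneOn_of_deriv_nonneg (convex_Icc a b) (fun t ht => (hD t ht).continuousWithinAt)
  · rw [interior_Icc]
    intro t ht
    exact ((hD t (Ioo_subset_Icc_self ht)).hasDerivAt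
      (Icc_mem_nhds ht.1 ht.2)).differentiableAt.differentiableWithinAt
  · rw [interior_Icc]
    intro t ht
    rw [((hD t (Ioo_subset_Icc_self ht)).hasDerivAt (Icc_mem_nhds ht.1 ht.2)).deriv]
    exact hE t ht

theorem hasDerivWithinAt_Icc_mono {a b c d : ℝ} {D E : ℝ → ℝ} (hac : a ≤ c) (hdb : d ≤ b)
    (hD : ∀ t ∈ Icc a b, HasDerivWithinAt D (E t) (Icc a b) t) :
    ∀ t ∈ Icc c d, HasDerivWithinAt D (E t) (Icc c d) t :=
  fun t ht => (hD t (Icc_subset_Icc hac hdb ht)).mono (Icc_subset_Icc hac hdb)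

/-- Maximum principle for `D'' ≥ k D`, `k ≥ 0`, with the differential inequality in integrated
form, where `E` is the derivative of `D`. -/
theorem pos_of_integral_le {a b : ℝ} {D E k : ℝ → ℝ}
    (hD : ∀ t ∈ Icc a b, HasDerivWithinAt D (E t) (Icc a b) t)
    (hk : ∀ t ∈ Icc a b, 0 ≤ k t)
    (h : ∀ t ∈ Icc a b, E a + ∫ s in a..t, k s * D s ≤ E t)
    (ha : 0 < D a) (hEa : 0 ≤ E a) :
    ∀ t ∈ Icc a b, 0 < D t ∧ E a ≤ E t := by
  have key : ∀ t ∈ Icc a b, (∀ s ∈ Icc a t, 0 < D s) → E a ≤ E t := by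
    intro t ht hs
    have : 0 ≤ ∫ s in a..t, k s * D s := by
      apply intervalIntegral.integral_nonneg ht.1
      intro s hs'
      exact mul_nonneg (hk s ⟨hs'.1, hs'.2.trans ht.2⟩) (hs s hs').le
    linarith [h t ht]
  have pos : ∀ t ∈ Icc a b, 0 < D t := by
    by_contra! hcon
    obtain ⟨t1, ht1, hD1⟩ := hcon
    have hcont : ContinuousOn D (Icc a b) := fun t ht => (hD t ht).continuousWithinAt
    have hcl : IsCompact (Icc a b ∩ D ⁻¹' Iic 0) :=
      isCompact_Icc.of_isClosed_subset
        (hcont.preimage_isClosed_of_isClosed isClosed_Icc isClosed_Iic) inter_subset_left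
    obtain ⟨t2, ⟨ht2, hD2⟩, hleast⟩ := hcl.exists_isLeast ⟨t1, ht1, hD1⟩
    have hpos : ∀ s ∈ Icc a b, s < t2 → 0 < D s := by
      intro s hs hlt
      by_contra! hle
      exact absurd (hleast ⟨hs, hle⟩) (not_le.mpr hlt)
    have hmono := monotoneOn_of_hasDerivWithinAt_nonneg
      (hasDerivWithinAt_Icc_mono le_rfl ht2.2 hD) (fun t ht => by
        refine hEa.trans (key t ⟨ht.1.le, ht.2.le.trans ht2.2⟩ fun s hs => ?_)
        exact hpos s ⟨hs.1, hs.2.trans (ht.2.le.trans ht2.2)⟩ (hs.2.trans_lt ht.2))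
    have := hmono ⟨le_rfl, ht2.1⟩ ⟨ht2.1, le_rfl⟩ ht2.1
    have h3 : D t2 ≤ 0 := hD2
    linarith
  exact fun t ht => ⟨pos t ht, key t ht fun s hs => pos s ⟨hs.1, hs.2.trans ht.2⟩⟩

/-- The coefficient of the first correction in the WKB expansion of `y'' = t^{2m} y`. -/
def wkbCoeff (m : ℝ) : ℝ := (m ^ 2 + 2 * m) / 4

/-- The logarithmic derivative of `wkb m`. -/
def wkbRate (m t : ℝ) : ℝ := t ^ m - m / 2 * t⁻¹ - wkbCoeff m * t ^ (-(m + 2))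

/-- A subsolution of `y'' = t^{2m} y` for large `t`, with the growth `t^{-m/2} e^{ξ(t)}` of the
growing solutions. -/
def wkb (m t : ℝ) : ℝ :=
  Real.exp (xi m t - m / 2 * Real.log t + wkbCoeff m / (m + 1) * t ^ (-(m + 1)))

theorem wkbCoeff_nonneg {m : ℝ} (hm : 0 ≤ m) : 0 ≤ wkbCoeff m := by
  unfold wkbCoeff; positivity

theorem hasDerivAt_wkb {m t : ℝ} (hm : 0 ≤ m) (ht : 0 < t) :
    HasDerivAt (wkb m) (wkbRate m t * wkb m t) t := by
  have h1 : HasDerivAt (xi m) (t ^ m) t := by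
    have := (Real.hasDerivAt_rpow_const (x := t) (p := m + 1) (Or.inl ht.ne')).div_const (m + 1)
    refine this.congr_deriv ?_
    rw [add_sub_cancel_right]
    field_simp
  have h2 := (Real.hasDerivAt_log ht.ne').const_mul (m / 2)
  have h3 := (Real.hasDerivAt_rpow_const (x := t) (p := -(m + 1)) (Or.inl ht.ne')).const_mul
    (wkbCoeff m / (m + 1))
  refine ((h1.sub h2).add h3).exp.congr_deriv ?_
  rw [mul_comm]
  unfold wkb wkbRate
  simp only [Pi.add_apply, Pi.sub_apply]
  congr 1
  rw [show -(m + 1) - 1 = -(m + 2) by ring]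
  field_simp
  ring

theorem hasDerivAt_wkbRate {m t : ℝ} (ht : 0 < t) :
    HasDerivAt (wkbRate m) (m * t ^ (m - 1) + m / 2 * (t ^ 2)⁻¹
      + wkbCoeff m * (m + 2) * t ^ (-(m + 3))) t := by
  have h1 := Real.hasDerivAt_rpow_const (x := t) (p := m) (Or.inl ht.ne')
  have h2 := (hasDerivAt_inv ht.ne').const_mul (m / 2)
  have h3 := (Real.hasDerivAt_rpow_const (x := t) (p := -(m + 2)) (Or.inl ht.ne')).const_mul
    (wkbCoeff m)
  refine ((h1.sub h2).sub h3).congr_deriv ?_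
  rw [show -(m + 2) - 1 = -(m + 3) by ring]
  ring

/-- The time from which `wkb m` is a subsolution. -/
def wkbStart (m : ℝ) : ℝ := 2 * m + 3 + 2 * wkbCoeff m

/-- For `t ≥ wkbStart m`, `wkb m` is a subsolution (first inequality), and its derivative is at
least `t^m / 2` times `wkb m`. -/
theorem wkb_estimates {m t : ℝ} (hm : 0 ≤ m) (ht : wkbStart m ≤ t) :
    m * t ^ (m - 1) + m / 2 * (t ^ 2)⁻¹ + wkbCoeff m * (m + 2) * t ^ (-(m + 3))
      + wkbRate m t ^ 2 ≤ t ^ (2 * m) ∧ t ^ m / 2 ≤ wkbRate m t := by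
  have hc := wkbCoeff_nonneg hm
  have ht3 : 3 ≤ t := by unfold wkbStart at ht; linarith
  have ht0 : 0 < t := by linarith
  set i := t⁻¹ with hi
  set a := t ^ m with ha
  set σ := t ^ (-(m + 1)) with hσ
  have e1 : t ^ (m - 1) = a * i := by rw [Real.rpow_sub_one ht0.ne', div_eq_mul_inv]
  have e2 : t ^ (-(m + 2)) = σ * i := by
    rw [show -(m + 2) = -(m + 1) - 1 by ring, Real.rpow_sub_one ht0.ne', div_eq_mul_inv]
  have e3 : t ^ (-(m + 3)) = σ * i * i := by
    rw [show -(m + 3) = -(m + 2) - 1 by ring, Real.rpow_sub_one ht0.ne', div_eq_mul_inv, e2]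
  have e4 : a * σ = i := by
    rw [ha, hσ, ← Real.rpow_add ht0, hi, ← Real.rpow_neg_one]; congr 1; ring
  have e5 : t ^ (2 * m) = a ^ 2 := by
    rw [ha, mul_comm, Real.rpow_mul ht0.le]; norm_cast
  have e6 : (t ^ 2)⁻¹ = i * i := by rw [hi, sq, mul_inv]
  have ha1 : 1 ≤ a := Real.one_le_rpow (by linarith) hm
  have hi0 : 0 < i := inv_pos.mpr ht0
  have hσ0 : 0 < σ := Real.rpow_pos_of_pos ht0 _
  have hσi : σ ≤ i := by nlinarith
  have hti : t * i = 1 := mul_inv_cancel₀ ht0.ne'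
  have hsi : wkbStart m * i ≤ 1 := by nlinarith
  have hi1 : i ≤ 1 := by nlinarith
  have hcm : m ^ 2 / 4 + m / 2 = wkbCoeff m := by unfold wkbCoeff; ring
  have hr : wkbRate m t = a - m / 2 * i - wkbCoeff m * (σ * i) := by rw [wkbRate, e2]
  unfold wkbStart at hsi
  constructor
  · rw [hr, e1, e3, e5, e6]
    have hb : (2 * m + 2) * σ + wkbCoeff m * σ ^ 2 ≤ 1 := by
      have : σ ^ 2 ≤ i := by nlinarith
      nlinarith
    have : m * (a * i) + m / 2 * (i * i) + wkbCoeff m * (m + 2) * (σ * i * i)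
        + (a - m / 2 * i - wkbCoeff m * (σ * i)) ^ 2
        = a ^ 2 + wkbCoeff m * i ^ 2 * ((2 * m + 2) * σ + wkbCoeff m * σ ^ 2 - 1) := by
      linear_combination (-2 * wkbCoeff m * i) * e4 + i ^ 2 * hcm
    rw [this]
    have : 0 ≤ wkbCoeff m * i ^ 2 := by positivity
    nlinarith
  · rw [hr]
    have : σ * i ≤ i := by nlinarith
    nlinarith

theorem le_wkb {m t : ℝ} (hm : 0 ≤ m) (ht : 0 < t) :
    t ^ (-(m / 2)) * Real.exp (xi m t) ≤ wkb m t := by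
  have hc := wkbCoeff_nonneg hm
  rw [Real.rpow_def_of_pos ht, ← Real.exp_add, wkb, Real.exp_le_exp]
  have : 0 ≤ wkbCoeff m / (m + 1) * t ^ (-(m + 1)) := by positivity
  linarith

/-- Exponential growth of the derivative of a function `U` with `U'' ≥ t^{2m} U`, given in
integrated form, and with positive data at `t = 0`. -/
theorem exists_exp_growth {m : ℝ} (hm : 0 ≤ m) :
    ∃ t₀ : ℝ, 1 ≤ t₀ ∧ ∃ c : ℝ, 0 < c ∧ ∀ (A b : ℝ) (U V : ℝ → ℝ), 0 < A →
      (∀ t ∈ Icc 0 b, HasDerivWithinAt U (V t) (Icc 0 b) t) →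
      (∀ s ∈ Icc 0 b, ∀ t ∈ Icc s b, V s + ∫ r in s..t, r ^ (2 * m) * U r ≤ V t) →
      A ≤ U 0 → A ≤ V 0 →
      ∀ t ∈ Icc t₀ b, c * A * t ^ (m / 2) * Real.exp (xi m t) ≤ V t := by
  have hc := wkbCoeff_nonneg hm
  set t₀ := wkbStart m with ht₀
  have ht1 : 1 ≤ t₀ := by rw [ht₀, wkbStart]; linarith
  have ht0 : 0 < t₀ := by linarith
  set y₀ := wkb m t₀ with hy₀
  set z₀ := wkbRate m t₀ * wkb m t₀ with hz₀
  have hw : ∀ t, 0 < wkb m t := fun t => Real.exp_pos _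
  have hrate : ∀ t, t₀ ≤ t → 0 < wkbRate m t := fun t ht =>
    lt_of_lt_of_le (by have : 0 < t := by linarith
                       positivity) (wkb_estimates hm ht).2
  have hy0 : 0 < y₀ := hw _
  have hz0 : 0 < z₀ := mul_pos (hrate _ le_rfl) (hw _)
  -- with this factor the subsolution starts below data of size one at `t₀`
  set δ := 1 / (y₀ + z₀ + 1) with hδ
  have hδ0 : 0 < δ := by positivity
  have hδ1 : δ * (y₀ + z₀ + 1) = 1 := by rw [hδ]; field_simp
  refine ⟨t₀, ht1, δ / 2, by positivity, ?_⟩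
  intro A b U V hA hU hV hU0 hV0 t ht
  have hb : t₀ ≤ b := ht.1.trans ht.2
  -- `U` and `V` stay above their initial values
  have hpos := pos_of_integral_le hU (k := fun s => s ^ (2 * m))
    (fun s hs => Real.rpow_nonneg hs.1 _)
    (fun s hs => hV 0 ⟨le_rfl, by linarith⟩ s hs) (by linarith) (by linarith)
  have hUmono := monotoneOn_of_hasDerivWithinAt_nonneg hU
    (fun s hs => by linarith [(hpos s (Ioo_subset_Icc_self hs)).2])
  have hUt0 : A ≤ U t₀ := hU0.trans (hUmono ⟨le_rfl, by linarith⟩ ⟨ht0.le, hb⟩ ht0.le)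
  have hVt0 : A ≤ V t₀ := hV0.trans (hpos t₀ ⟨ht0.le, hb⟩).2
  -- comparison with the subsolution `A δ wkb`
  have hYd : ∀ s, t₀ ≤ s → HasDerivAt (fun r => wkbRate m r * wkb m r)
      ((m * s ^ (m - 1) + m / 2 * (s ^ 2)⁻¹ + wkbCoeff m * (m + 2) * s ^ (-(m + 3))
      + wkbRate m s ^ 2) * wkb m s) s := by
    intro s hs
    refine ((hasDerivAt_wkbRate (m := m) (by linarith)).mul
      (hasDerivAt_wkb hm (t := s) (by linarith))).congr_deriv ?_
    ring
  have hcontY : ContinuousOn (wkb m) (Icc t₀ b) := fun s hs =>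
    (hasDerivAt_wkb hm (by linarith [hs.1])).continuousAt.continuousWithinAt
  have hcontU : ContinuousOn U (Icc t₀ b) := fun s hs =>
    ((hU s ⟨by linarith [hs.1], hs.2⟩).continuousWithinAt).mono (Icc_subset_Icc ht0.le le_rfl)
  have hcontp : Continuous fun s : ℝ => s ^ (2 * m) :=
    Real.continuous_rpow_const (by positivity)
  have hsub : ∀ s ∈ Icc t₀ b,
      wkbRate m s * wkb m s ≤ z₀ + ∫ r in t₀..s, r ^ (2 * m) * wkb m r := by
    intro s hs
    have hI : ContinuousOn (fun r => r ^ (2 * m) * wkb m r) (Icc t₀ s) :=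
      hcontp.continuousOn.mul (hcontY.mono (Icc_subset_Icc le_rfl hs.2))
    have := intervalIntegral.sub_le_integral_of_hasDeriv_right_of_le hs.1
      (fun r hr => (hYd r hr.1).continuousAt.continuousWithinAt)
      (fun r hr => (hYd r hr.1.le).hasDerivWithinAt) hI.integrableOn_Icc
      (fun r hr => mul_le_mul_of_nonneg_right (wkb_estimates hm hr.1.le).1 (hw r).le)
    linarith
  have hD := pos_of_integral_le (a := t₀) (b := b) (D := fun s => U s - A * δ * wkb m s)
    (E := fun s => V s - A * δ * (wkbRate m s * wkb m s)) (k := fun s => s ^ (2 * m))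
    (fun s hs => ((hU s ⟨by linarith [hs.1], hs.2⟩).mono (Icc_subset_Icc ht0.le le_rfl)).sub
      ((hasDerivAt_wkb hm (by linarith [hs.1])).hasDerivWithinAt.const_mul _))
    (fun s hs => Real.rpow_nonneg (by linarith [hs.1]) _)
    (by
      intro s hs
      have hI1 : IntervalIntegrable (fun r => r ^ (2 * m) * U r) volume t₀ s := by
        apply ContinuousOn.intervalIntegrable
        rw [uIcc_of_le hs.1]
        exact hcontp.continuousOn.mul (hcontU.mono (Icc_subset_Icc le_rfl hs.2))
      have hI2 : IntervalIntegrable (fun r => A * δ * (r ^ (2 * m) * wkb m r)) volume t₀ s := by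
        apply ContinuousOn.intervalIntegrable
        rw [uIcc_of_le hs.1]
        exact continuousOn_const.mul
          (hcontp.continuousOn.mul (hcontY.mono (Icc_subset_Icc le_rfl hs.2)))
      have h1 := hV t₀ ⟨ht0.le, hb⟩ s hs
      have h2 := mul_le_mul_of_nonneg_left (hsub s hs) (by positivity : 0 ≤ A * δ)
      have h3 : ∫ r in t₀..s, r ^ (2 * m) * (U r - A * δ * wkb m r)
          = (∫ r in t₀..s, r ^ (2 * m) * U r)
            - A * δ * ∫ r in t₀..s, r ^ (2 * m) * wkb m r := by
        rw [← intervalIntegral.integral_const_mul, ← intervalIntegral.integral_sub hI1 hI2]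
        congr 1; ext r; ring
      simp only [h3]
      linarith)
    (by
      have : A * (δ * y₀) < A * 1 := by
        apply mul_lt_mul_of_pos_left _ hA; nlinarith
      simp only [← hy₀]; linarith)
    (by
      have : A * (δ * z₀) ≤ A * 1 := by
        apply mul_le_mul_of_nonneg_left _ hA.le; nlinarith
      simp only [← hz₀]; linarith) t ht
  have h1 := (wkb_estimates hm ht.1).2
  have htpos : 0 < t := by linarith [ht.1]
  have h2 := le_wkb hm htpos
  have h3 : t ^ m / 2 * (t ^ (-(m / 2)) * Real.exp (xi m t)) ≤ wkbRate m t * wkb m t :=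
    mul_le_mul h1 h2 (by positivity) (hrate t ht.1).le
  have h4 : t ^ m * t ^ (-(m / 2)) = t ^ (m / 2) := by
    rw [← Real.rpow_add htpos]; congr 1; ring
  have h5 := mul_le_mul_of_nonneg_left h3 (by positivity : 0 ≤ A * δ)
  have hz : A * (δ * z₀) ≤ A * 1 := by
    apply mul_le_mul_of_nonneg_left _ hA.le; nlinarith
  have hE := hD.2
  calc δ / 2 * A * t ^ (m / 2) * Real.exp (xi m t)
      = A * δ * (t ^ m / 2 * (t ^ (-(m / 2)) * Real.exp (xi m t))) := by rw [← h4]; ring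
    _ ≤ A * δ * (wkbRate m t * wkb m t) := h5
    _ ≤ V t := by simp only [← hz₀] at hE; linarith

/-- Blow-up within the time interval `[τ, 2τ]` for `F'' ≥ K F^q`, given in integrated form, when
`K` and the initial value are large enough. The time in which `F` doubles decays geometrically. -/
theorem exists_blowup_const {q : ℝ} (hq : 1 < q) :
    ∃ M : ℝ, 0 < M ∧ ∀ (τ K F₀ : ℝ) (F V : ℝ → ℝ), 0 < τ → 0 < K → 0 < F₀ →
      (∀ t ∈ Icc τ (2 * τ), HasDerivWithinAt F (V t) (Icc τ (2 * τ)) t) →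
      (∀ s ∈ Icc τ (2 * τ), 0 ≤ V s) →
      (∀ s ∈ Icc τ (2 * τ), ∀ t ∈ Icc s (2 * τ), ∀ L : ℝ, 0 < L → (∀ r ∈ Icc s t, L ≤ F r) →
        V s + K * L ^ q * (t - s) ≤ V t) →
      F₀ ≤ F τ → K * F₀ ^ (q - 1) * τ ^ 2 < M := by
  set x : ℝ := 2 ^ (-((q - 1) / 2)) with hx
  have hx0 : 0 < x := by positivity
  have hx1 : x < 1 := Real.rpow_lt_one_of_one_lt_of_neg (by norm_num) (by linarith)
  have hx1' : 0 < 1 - x := by linarith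
  refine ⟨2 / (1 - x) ^ 2, by positivity, ?_⟩
  intro τ K F₀ F V hτ hK hF₀ hF hV0 hV hini
  by_contra! hM
  -- the first doubling time
  set h : ℝ := τ * (1 - x) with hh
  have hh0 : 0 < h := by positivity
  have hhK : 2 ≤ K * F₀ ^ (q - 1) * h ^ 2 := by
    rw [div_le_iff₀ (by positivity)] at hM
    rw [hh]; nlinarith
  have hmono := monotoneOn_of_hasDerivWithinAt_nonneg hF
    (fun t ht => hV0 t (Ioo_subset_Icc_self ht))
  have step : ∀ k : ℕ, ∀ t ∈ Icc (2 * τ - τ * x ^ k) (2 * τ), 2 ^ k * F₀ ≤ F t := by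
    intro k
    induction k with
    | zero =>
      intro t ht
      have hτt : τ ≤ t := by have := ht.1; simp at this; linarith
      simpa using hini.trans (hmono ⟨le_rfl, by linarith⟩ ⟨hτt, ht.2⟩ hτt)
    | succ k ih =>
      intro t ht
      set s := 2 * τ - τ * x ^ k with hs
      set L := 2 ^ k * F₀ with hL
      have hL0 : 0 < L := by positivity
      have hxk : x ^ k ≤ 1 := pow_le_one₀ hx0.le hx1.le
      have hxk0 : 0 < x ^ k := by positivity
      have hst : h * x ^ k ≤ t - s := by
        have := ht.1
        rw [pow_succ] at this
        rw [hs, hh]; linarith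
      have hst0 : s ≤ t := by nlinarith
      have hτs : τ ≤ s := by rw [hs]; nlinarith
      have hsub : Icc s t ⊆ Icc τ (2 * τ) := Icc_subset_Icc hτs ht.2
      have hLF : ∀ r ∈ Icc s t, L ≤ F r := fun r hr => ih r ⟨hr.1, hr.2.trans ht.2⟩
      have hd : ∀ r ∈ Icc s t, HasDerivWithinAt (fun r => F r - K * L ^ q * ((r - s) ^ 2 / 2))
          (V r - K * L ^ q * (r - s)) (Icc s t) r := by
        intro r hr
        refine ((hF r (hsub hr)).mono hsub).sub (HasDerivAt.hasDerivWithinAt ?_)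
        have := ((((hasDerivAt_id r).sub_const s).pow 2).div_const 2).const_mul (K * L ^ q)
        refine this.congr_deriv ?_
        simp
      have hm := monotoneOn_of_hasDerivWithinAt_nonneg hd (fun r hr => by
        have := hV s ⟨hτs, hst0.trans ht.2⟩ r ⟨hr.1.le, hr.2.le.trans ht.2⟩ L hL0
          (fun r' hr' => hLF r' ⟨hr'.1, hr'.2.trans hr.2.le⟩)
        linarith [hV0 s ⟨hτs, hst0.trans ht.2⟩]) ⟨le_rfl, hst0⟩ ⟨hst0, le_rfl⟩ hst0
      simp only [sub_self] at hm
      have hLs := hLF s ⟨le_rfl, hst0⟩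
      -- the doubling time is the one for `F₀`, times `x ^ k`
      have hxL : L ^ (q - 1) * (x ^ k) ^ 2 = F₀ ^ (q - 1) := by
        rw [hL, Real.mul_rpow (by positivity) hF₀.le, mul_right_comm]
        have : ((2 : ℝ) ^ k) ^ (q - 1) * (x ^ k) ^ 2 = 1 := by
          rw [← pow_mul, mul_comm k 2, pow_mul, hx, ← Real.rpow_natCast (2 ^ _) 2,
            ← Real.rpow_mul (by norm_num), ← Real.rpow_natCast 2 k, ← Real.rpow_natCast _ k,
            ← Real.rpow_mul (by norm_num), ← Real.rpow_mul (by norm_num),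
            ← Real.rpow_add (by norm_num)]
          convert Real.rpow_zero 2 using 2
          push_cast; ring
        rw [this, one_mul]
      have hLq : L ^ q = L ^ (q - 1) * L := by
        rw [← Real.rpow_add_one hL0.ne']; congr 1; ring
      have hsq : (h * x ^ k) ^ 2 ≤ (t - s) ^ 2 := pow_le_pow_left₀ (by positivity) hst 2
      have : 2 * L ≤ K * L ^ q * (t - s) ^ 2 := by
        calc 2 * L ≤ K * F₀ ^ (q - 1) * h ^ 2 * L := by gcongr
          _ = K * L ^ q * (h * x ^ k) ^ 2 := by rw [hLq, ← hxL]; ring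
          _ ≤ _ := by gcongr
      rw [pow_succ]
      nlinarith
  obtain ⟨k, hk⟩ := pow_unbounded_of_one_lt (F (2 * τ) / F₀) (by norm_num : (1 : ℝ) < 2)
  rw [div_lt_iff₀ hF₀] at hk
  have := step k (2 * τ) ⟨by have : 0 < τ * x ^ k := by positivity
                             linarith, le_rfl⟩
  linarith

/-! ### The positive eigenfunction of the Laplacian -/

open scoped Nat in
/-- The coefficients of `besselSeries`. -/
def besselCoeff (α : ℝ) (k : ℕ) : ℝ := 1 / (k ! * Real.Gamma (k + α))

/-- The entire function `∑ sᵏ / (k! Γ(k + α))`. In terms of the modified Bessel function it is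
`s^{(1 - α) / 2} I_{α - 1}(2 √s)`. -/
def besselSeries (α s : ℝ) : ℝ := ∑' k : ℕ, besselCoeff α k * s ^ k

theorem Gamma_natCast_add_pos {α : ℝ} (hα : 0 < α) (k : ℕ) : 0 < Real.Gamma (k + α) :=
  Real.Gamma_pos_of_pos (by positivity)

theorem besselCoeff_pos {α : ℝ} (hα : 0 < α) (k : ℕ) : 0 < besselCoeff α k := by
  have := Gamma_natCast_add_pos hα k
  unfold besselCoeff; positivity

open scoped Nat in
theorem exists_besselCoeff_le {α : ℝ} (hα : 0 < α) :
    ∃ C : ℝ, 0 < C ∧ ∀ k : ℕ, besselCoeff α k ≤ C * (1 / k !) := by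
  have hG := Gamma_natCast_add_pos hα
  have h0 := hG 0
  have h1 := hG 1
  refine ⟨1 / Real.Gamma ((0 : ℕ) + α) + 1 / Real.Gamma ((1 : ℕ) + α), by positivity, ?_⟩
  have key : ∀ k : ℕ, Real.Gamma ((1 : ℕ) + α) ≤ Real.Gamma ((k + 1 : ℕ) + α) := by
    intro k
    induction k with
    | zero => simp
    | succ k ih =>
      refine ih.trans ?_
      have : ((k + 1 + 1 : ℕ) : ℝ) + α = ((k + 1 : ℕ) + α) + 1 := by push_cast; ring
      rw [this, Real.Gamma_add_one (by positivity)]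
      have := hG (k + 1)
      have : (1 : ℝ) ≤ ((k + 1 : ℕ) : ℝ) + α := by
        push_cast; have : (0 : ℝ) ≤ k := by positivity
        linarith
      nlinarith
  intro k
  have hk : 1 / Real.Gamma (k + α)
      ≤ 1 / Real.Gamma ((0 : ℕ) + α) + 1 / Real.Gamma ((1 : ℕ) + α) := by
    cases k with
    | zero => have : 0 < 1 / Real.Gamma ((1 : ℕ) + α) := by positivity
              linarith
    | succ k =>
      have := one_div_le_one_div_of_le h1 (key k)
      have : 0 < 1 / Real.Gamma ((0 : ℕ) + α) := by positivity
      linarith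
  have hk' := hG k
  calc besselCoeff α k = 1 / Real.Gamma (k + α) * (1 / k !) := by
        unfold besselCoeff; field_simp
    _ ≤ _ := by gcongr

theorem summable_besselCoeff {α : ℝ} (hα : 0 < α) (s : ℝ) :
    Summable fun k : ℕ => besselCoeff α k * s ^ k := by
  obtain ⟨C, hC, h⟩ := exists_besselCoeff_le hα
  refine Summable.of_norm_bounded ((Real.summable_pow_div_factorial |s|).mul_left C) fun k => ?_
  rw [norm_mul, norm_pow, Real.norm_eq_abs, abs_of_pos (besselCoeff_pos hα k), Real.norm_eq_abs]
  calc besselCoeff α k * |s| ^ k ≤ C * (1 / k.factorial) * |s| ^ k := by gcongr; exact h k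
    _ = _ := by ring

theorem besselCoeff_succ {α : ℝ} (k : ℕ) :
    besselCoeff α (k + 1) * (k + 1) = besselCoeff (α + 1) k := by
  unfold besselCoeff
  have : ((k + 1 : ℕ) : ℝ) + α = k + (α + 1) := by push_cast; ring
  rw [this, Nat.factorial_succ]
  push_cast
  by_cases h : Real.Gamma (k + (α + 1)) = 0
  · simp [h]
  field_simp

theorem hasDerivAt_besselSeries {α : ℝ} (hα : 0 < α) (s : ℝ) :
    HasDerivAt (besselSeries α) (besselSeries (α + 1) s) s := by
  obtain ⟨C, hC, h⟩ := exists_besselCoeff_le (α := α + 1) (by linarith)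
  have hsplit : besselSeries α
      = fun s => besselCoeff α 0 + ∑' k : ℕ, besselCoeff α (k + 1) * s ^ (k + 1) := by
    ext s
    rw [besselSeries, (summable_besselCoeff hα s).tsum_eq_zero_add]
    simp
  rw [hsplit]
  refine HasDerivAt.const_add _ ?_
  refine hasDerivAt_tsum_of_isPreconnected (𝕜 := ℝ) (F := ℝ)
    (g := fun (k : ℕ) (s : ℝ) => besselCoeff α (k + 1) * s ^ (k + 1))
    (g' := fun (k : ℕ) (s : ℝ) => besselCoeff (α + 1) k * s ^ k)
    (u := fun k : ℕ => C * ((|s| + 1) ^ k / k.factorial)) (t := Metric.ball (0 : ℝ) (|s| + 1))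
    (y₀ := (0 : ℝ)) ((Real.summable_pow_div_factorial _).mul_left C) Metric.isOpen_ball
    (convex_ball (0 : ℝ) (|s| + 1)).isPreconnected (fun k y _ => ?_) (fun k y hy => ?_) ?_ ?_ ?_
  · have := (hasDerivAt_pow (k + 1) y).const_mul (besselCoeff α (k + 1))
    refine this.congr_deriv ?_
    rw [← besselCoeff_succ]
    push_cast [Nat.add_sub_cancel]
    ring
  · rw [mem_ball_zero_iff, Real.norm_eq_abs] at hy
    rw [norm_mul, norm_pow, Real.norm_eq_abs, Real.norm_eq_abs,
      abs_of_pos (besselCoeff_pos (by linarith) k)]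
    calc besselCoeff (α + 1) k * |y| ^ k ≤ C * (1 / k.factorial) * (|s| + 1) ^ k := by
          gcongr; exact h k
      _ = _ := by ring
  · simp; positivity
  · simp
  · simp

theorem contDiff_besselSeries {α : ℝ} (hα : 0 < α) : ContDiff ℝ ∞ (besselSeries α) := by
  rw [contDiff_infty]
  intro n
  induction n generalizing α with
  | zero =>
    simp only [Nat.cast_zero, contDiff_zero]
    exact continuous_iff_continuousAt.mpr fun s => (hasDerivAt_besselSeries hα s).continuousAt
  | succ n ih =>
    push_cast
    rw [contDiff_succ_iff_deriv]
    refine ⟨fun s => (hasDerivAt_besselSeries hα s).differentiableAt, by simp, ?_⟩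
    rw [show deriv (besselSeries α) = besselSeries (α + 1) from
      funext fun s => (hasDerivAt_besselSeries hα s).deriv]
    exact ih (by linarith)

/-- The differential equation `s J'' + α J' = J` of `J = besselSeries α`. -/
theorem besselSeries_ode {α : ℝ} (hα : 0 < α) (s : ℝ) :
    s * besselSeries (α + 2) s + α * besselSeries (α + 1) s = besselSeries α s := by
  have h1 := summable_besselCoeff (α := α + 1) (by linarith) s
  have h2 := summable_besselCoeff (α := α + 2) (by linarith) s
  have h0 := summable_besselCoeff hα s
  have e : ∀ k : ℕ, (k + α) * besselCoeff (α + 1) k = besselCoeff α k := by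
    intro k
    have := Gamma_natCast_add_pos hα k
    unfold besselCoeff
    rw [show (k : ℝ) + (α + 1) = (k + α) + 1 by ring, Real.Gamma_add_one (by positivity)]
    field_simp
  unfold besselSeries
  rw [h1.tsum_eq_zero_add, h0.tsum_eq_zero_add, ← tsum_mul_left, mul_add, ← tsum_mul_left,
    add_left_comm, ← ((h2.mul_left s)).tsum_add
      (((summable_nat_add_iff 1).mpr h1).mul_left α)]
  congr 1
  · rw [← e 0]; simp
  · congr 1; ext k
    rw [← e (k + 1), show α + 2 = α + 1 + 1 by ring, ← besselCoeff_succ]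
    push_cast; ring

theorem besselSeries_pos {α s : ℝ} (hα : 0 < α) (hs : 0 ≤ s) : 0 < besselSeries α s := by
  have := (summable_besselCoeff hα s).le_tsum 0
    (fun k _ => mul_nonneg (besselCoeff_pos hα k).le (pow_nonneg hs k))
  have h0 := besselCoeff_pos hα 0
  simp only [pow_zero, mul_one] at this
  exact h0.trans_le this

theorem Gamma_add_half_le {x : ℝ} (hx : 0 < x) :
    Real.Gamma (x + 1 / 2) ≤ √x * Real.Gamma x := by
  have h := Real.Gamma_mul_add_mul_le_rpow_Gamma_mul_rpow_Gamma hx (by linarith : 0 < x + 1)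
    (by norm_num : (0 : ℝ) < 1 / 2) (by norm_num : (0 : ℝ) < 1 / 2) (by norm_num)
  have hG := Real.Gamma_pos_of_pos hx
  rw [Real.Gamma_add_one hx.ne', Real.mul_rpow hx.le hG.le, ← Real.sqrt_eq_rpow,
    ← Real.sqrt_eq_rpow] at h
  calc Real.Gamma (x + 1 / 2) = Real.Gamma (1 / 2 * x + 1 / 2 * (x + 1)) := by congr 1; ring
    _ ≤ _ := h
    _ = √x * (√(Real.Gamma x) * √(Real.Gamma x)) := by ring
    _ = _ := by rw [Real.mul_self_sqrt hG.le]

open scoped Nat in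
/-- By the duplication formula, `4ᵏ k! Γ(k + (n+1)/2)` is at least of the size of the geometric
mean of `(2k)!` and `(2k+n)!`. -/
theorem exists_factorial_mul_le (n : ℕ) : ∃ C : ℝ, 1 ≤ C ∧ ∀ k : ℕ,
    ((2 * k)! : ℝ) * (2 * k + n)! ≤ C * (4 ^ k * (k ! * Real.Gamma (k + (n + 1) / 2))) ^ 2 := by
  set α : ℝ := (n + 1) / 2 with hα
  have hα0 : 0 < α := by positivity
  refine ⟨2 ^ n * (1 + α), by
    have : (1 : ℝ) ≤ 2 ^ n := one_le_pow₀ (by norm_num)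
    nlinarith, fun k => ?_⟩
  have hG := Gamma_natCast_add_pos hα0 k
  have hk : (0 : ℝ) ≤ k := by positivity
  have hpi : (1 : ℝ) ≤ √Real.pi * √Real.pi := by
    rw [Real.mul_self_sqrt Real.pi_pos.le]; linarith [Real.pi_gt_three]
  have hpi0 : 0 < √Real.pi := Real.sqrt_pos.mpr Real.pi_pos
  -- the duplication formula for both factorials
  have d1 : ((2 * k)! : ℝ) * √Real.pi = 4 ^ k * (k ! * Real.Gamma (k + 1 / 2)) := by
    have h := Real.Gamma_mul_Gamma_add_half (k + 1 / 2)
    rw [show (k : ℝ) + 1 / 2 + 1 / 2 = k + 1 by ring, Real.Gamma_nat_eq_factorial,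
      show 2 * ((k : ℝ) + 1 / 2) = ((2 * k : ℕ) : ℝ) + 1 by push_cast; ring,
      Real.Gamma_nat_eq_factorial,
      show (1 : ℝ) - (((2 * k : ℕ) : ℝ) + 1) = -((2 * k : ℕ) : ℝ) by ring,
      Real.rpow_neg (by norm_num), Real.rpow_natCast, pow_mul] at h
    rw [show (2 : ℝ) ^ 2 = 4 by norm_num] at h
    have h4 : (0 : ℝ) < 4 ^ k := by positivity
    rw [mul_comm (Nat.factorial k : ℝ), h]
    field_simp
  have d2 : ((2 * k + n)! : ℝ) * √Real.pi
      = 4 ^ k * 2 ^ n * (Real.Gamma (k + α) * Real.Gamma (k + α + 1 / 2)) := by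
    have h := Real.Gamma_mul_Gamma_add_half (k + α)
    rw [show 2 * ((k : ℝ) + α) = ((2 * k + n : ℕ) : ℝ) + 1 by rw [hα]; push_cast; ring,
      Real.Gamma_nat_eq_factorial,
      show (1 : ℝ) - (((2 * k + n : ℕ) : ℝ) + 1) = -((2 * k + n : ℕ) : ℝ) by ring,
      Real.rpow_neg (by norm_num), Real.rpow_natCast, pow_add, pow_mul] at h
    rw [show (2 : ℝ) ^ 2 = 4 by norm_num] at h
    have h4 : (0 : ℝ) < 4 ^ k := by positivity
    rw [h]
    field_simp
  have hh1 := Gamma_add_half_le (x := k + 1) (by positivity)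
  rw [show (k : ℝ) + 1 + 1 / 2 = k + 1 / 2 + 1 by ring, Real.Gamma_add_one (by positivity),
    Real.Gamma_nat_eq_factorial] at hh1
  have hh2 := Gamma_add_half_le (x := k + α) (by positivity)
  have hg1 : 0 < Real.Gamma ((k : ℝ) + 1 / 2) := Real.Gamma_pos_of_pos (by positivity)
  have hg2 : 0 < Real.Gamma ((k : ℝ) + α + 1 / 2) := Real.Gamma_pos_of_pos (by positivity)
  have hsq : √((k : ℝ) + 1) * √(k + α) ≤ (1 + α) * (k + 1 / 2) := by
    have s1 := Real.sq_sqrt (by positivity : (0 : ℝ) ≤ (k : ℝ) + 1)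
    have s2 := Real.sq_sqrt (by positivity : (0 : ℝ) ≤ (k : ℝ) + α)
    nlinarith [sq_nonneg (√((k : ℝ) + 1) - √(k + α))]
  have hprod : Real.Gamma ((k : ℝ) + 1 / 2) * Real.Gamma ((k : ℝ) + α + 1 / 2)
      ≤ (1 + α) * (k ! * Real.Gamma (k + α)) := by
    have hk2 : (0 : ℝ) < k + 1 / 2 := by positivity
    refine le_of_mul_le_mul_left ?_ hk2
    calc ((k : ℝ) + 1 / 2) * (Real.Gamma ((k : ℝ) + 1 / 2) * Real.Gamma ((k : ℝ) + α + 1 / 2))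
        = (((k : ℝ) + 1 / 2) * Real.Gamma ((k : ℝ) + 1 / 2))
            * Real.Gamma ((k : ℝ) + α + 1 / 2) := by ring
      _ ≤ (√((k : ℝ) + 1) * k !) * (√(k + α) * Real.Gamma (k + α)) := by gcongr
      _ = √((k : ℝ) + 1) * √(k + α) * (k ! * Real.Gamma (k + α)) := by ring
      _ ≤ (1 + α) * (k + 1 / 2) * (k ! * Real.Gamma (k + α)) := by gcongr
      _ = _ := by ring
  calc ((2 * k)! : ℝ) * (2 * k + n)!
      ≤ ((2 * k)! : ℝ) * (2 * k + n)! * (√Real.pi * √Real.pi) :=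
        le_mul_of_one_le_right (by positivity) hpi
    _ = ((2 * k)! * √Real.pi) * ((2 * k + n)! * √Real.pi) := by ring
    _ = 2 ^ n * ((4 ^ k) ^ 2 * (k ! * Real.Gamma (k + α))) *
          (Real.Gamma ((k : ℝ) + 1 / 2) * Real.Gamma ((k : ℝ) + α + 1 / 2)) := by
        rw [d1, d2]; ring
    _ ≤ 2 ^ n * ((4 ^ k) ^ 2 * (k ! * Real.Gamma (k + α))) *
          ((1 + α) * (k ! * Real.Gamma (k + α))) := by gcongr
    _ = _ := by ring

open scoped Nat in
theorem tsum_even_shift_le (n : ℕ) {r : ℝ} (hr : 0 ≤ r) :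
    Summable (fun k : ℕ => r ^ (2 * k) / ((2 * k + n)! : ℝ)) ∧
    r ^ n * ∑' k : ℕ, r ^ (2 * k) / ((2 * k + n)! : ℝ) ≤ Real.exp r := by
  have hs := Real.summable_pow_div_factorial r
  have he : Real.exp r = ∑' k : ℕ, r ^ k / (k ! : ℝ) := by
    rw [Real.exp_eq_exp_ℝ, NormedSpace.exp_eq_tsum_div]
  have hinj : Function.Injective fun k : ℕ => 2 * k + n := fun a b h => by
    simp only at h; omega
  have hinj0 : Function.Injective fun k : ℕ => 2 * k := fun a b h => by
    simp only at h; omega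
  constructor
  · refine Summable.of_nonneg_of_le (fun k => by positivity) (fun k => ?_)
      (hs.comp_injective hinj0)
    have : ((2 * k)! : ℝ) ≤ (2 * k + n)! := by
      exact_mod_cast Nat.factorial_le (by omega)
    simp only [Function.comp]
    gcongr
  · rw [he, ← tsum_mul_left]
    have := tsum_comp_le_tsum_of_inj hs (fun k => by positivity) hinj
    refine le_trans (le_of_eq ?_) this
    congr 1; ext k
    simp only [Function.comp]
    rw [pow_add]; ring

open scoped Nat in
/-- Growth of the radial profile of the eigenfunction in dimension `n + 1`. -/
theorem exists_besselSeries_le (n : ℕ) : ∃ C : ℝ, 0 < C ∧ ∀ r : ℝ, 0 ≤ r →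
    besselSeries ((n + 1) / 2) (r ^ 2 / 4) ≤ C * ((1 + r) ^ (-((n : ℝ) / 2)) * Real.exp r) := by
  obtain ⟨C, hC1, hC⟩ := exists_factorial_mul_le n
  have hα : (0 : ℝ) < ((n : ℝ) + 1) / 2 := by positivity
  refine ⟨C * (1 + 2 ^ (n + 1)), by positivity, fun r hr => ?_⟩
  -- `l` is the target decay rate; it serves as the weight in the mean inequality below
  set l : ℝ := (1 + r) ^ (-((n : ℝ) / 2)) with hl
  have hl0 : 0 < l := by positivity
  have hll : l ^ 2 * (1 + r) ^ n = 1 := by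
    rw [hl, ← Real.rpow_natCast _ 2, ← Real.rpow_mul (by positivity), ← Real.rpow_natCast _ n,
      ← Real.rpow_add (by positivity)]
    convert Real.rpow_zero (1 + r) using 2
    push_cast; ring
  obtain ⟨s0, h0⟩ := tsum_even_shift_le 0 hr
  obtain ⟨sn, hn⟩ := tsum_even_shift_le n hr
  simp only [add_zero, pow_zero, one_mul] at s0 h0
  set S0 := ∑' k : ℕ, r ^ (2 * k) / ((2 * k)! : ℝ) with hS0
  set Sn := ∑' k : ℕ, r ^ (2 * k) / ((2 * k + n)! : ℝ) with hSn
  have hSn0 : 0 ≤ Sn := tsum_nonneg fun k => by positivity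
  -- weighted arithmetic-geometric mean inequality for the coefficients
  have hcoef : ∀ k : ℕ, besselCoeff (((n : ℝ) + 1) / 2) k * (r ^ 2 / 4) ^ k
      ≤ C * (l * (r ^ (2 * k) / ((2 * k)! : ℝ)) + l⁻¹ * (r ^ (2 * k) / ((2 * k + n)! : ℝ))) := by
    intro k
    have hG := Gamma_natCast_add_pos hα k
    set a : ℝ := ((2 * k)! : ℝ)
    set b : ℝ := ((2 * k + n)! : ℝ)
    have ha : 0 < a := by positivity
    have hb : 0 < b := by positivity
    set d : ℝ := 4 ^ k * (k ! * Real.Gamma (k + (n + 1) / 2)) with hd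
    have hd0 : 0 < d := by positivity
    have habd : a * b ≤ C * d ^ 2 := hC k
    have hmean : 1 / d ≤ C * (l / a + l⁻¹ / b) := by
      refine le_of_sq_le_sq ?_ (by positivity)
      have h1 : (1 / d) ^ 2 ≤ C * (1 / (a * b)) := by
        rw [div_pow, one_pow, mul_one_div, div_le_div_iff₀ (by positivity) (by positivity)]
        linarith
      have h2 : 1 / (a * b) ≤ (l / a + l⁻¹ / b) ^ 2 := by
        have : l / a * (l⁻¹ / b) = 1 / (a * b) := by field_simp
        have p1 : 0 < l / a := by positivity
        have p2 : 0 < l⁻¹ / b := by positivity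
        nlinarith
      have h3 : C * (1 / (a * b)) ≤ C ^ 2 * (1 / (a * b)) := by
        have : 0 < 1 / (a * b) := by positivity
        have : C ≤ C ^ 2 := by nlinarith
        gcongr
      rw [mul_pow]
      have := mul_le_mul_of_nonneg_left h2 (sq_nonneg C)
      linarith
    have e1 : besselCoeff (((n : ℝ) + 1) / 2) k * (r ^ 2 / 4) ^ k = r ^ (2 * k) * (1 / d) := by
      rw [hd, besselCoeff, div_pow, pow_mul]; field_simp
    rw [e1]
    calc r ^ (2 * k) * (1 / d) ≤ r ^ (2 * k) * (C * (l / a + l⁻¹ / b)) := by gcongr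
      _ = _ := by ring
  have hsum : Summable fun k : ℕ => C * (l * (r ^ (2 * k) / ((2 * k)! : ℝ))
      + l⁻¹ * (r ^ (2 * k) / ((2 * k + n)! : ℝ))) :=
    ((s0.mul_left l).add (sn.mul_left l⁻¹)).mul_left C
  have hle : besselSeries ((n + 1) / 2) (r ^ 2 / 4) ≤ C * (l * S0 + l⁻¹ * Sn) := by
    refine ((summable_besselCoeff hα _).tsum_le_tsum hcoef hsum).trans (le_of_eq ?_)
    rw [tsum_mul_left, (s0.mul_left l).tsum_add (sn.mul_left l⁻¹), tsum_mul_left, tsum_mul_left]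
  have hSnS0 : Sn ≤ S0 := sn.tsum_le_tsum (fun k => by
    have : ((2 * k)! : ℝ) ≤ (2 * k + n)! := by exact_mod_cast Nat.factorial_le (by omega)
    gcongr) s0
  have hpow : (1 + r) ^ n ≤ 2 ^ n * (1 + r ^ n) := by
    rcases le_total r 1 with h | h
    · calc (1 + r) ^ n ≤ 2 ^ n := by gcongr; linarith
        _ ≤ _ := le_mul_of_one_le_right (by positivity) (by have := pow_nonneg hr n; linarith)
    · calc (1 + r) ^ n ≤ (2 * r) ^ n := by gcongr; linarith
        _ = 2 ^ n * r ^ n := mul_pow _ _ _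
        _ ≤ _ := by gcongr; linarith
  have hSn2 : l⁻¹ * Sn ≤ 2 ^ (n + 1) * (l * Real.exp r) := by
    have e : l⁻¹ = l * (1 + r) ^ n := by
      field_simp; linarith
    have : (1 + r) ^ n * Sn ≤ 2 ^ (n + 1) * Real.exp r := by
      calc (1 + r) ^ n * Sn ≤ 2 ^ n * (1 + r ^ n) * Sn := by gcongr
        _ = 2 ^ n * (Sn + r ^ n * Sn) := by ring
        _ ≤ 2 ^ n * (Real.exp r + Real.exp r) := by gcongr; exact hSnS0.trans h0
        _ = _ := by ring
    rw [e]
    calc l * (1 + r) ^ n * Sn = l * ((1 + r) ^ n * Sn) := by ring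
      _ ≤ l * (2 ^ (n + 1) * Real.exp r) := by gcongr
      _ = _ := by ring
  calc besselSeries ((n + 1) / 2) (r ^ 2 / 4) ≤ C * (l * S0 + l⁻¹ * Sn) := hle
    _ ≤ C * (l * Real.exp r + 2 ^ (n + 1) * (l * Real.exp r)) := by gcongr
    _ = _ := by ring

/-- A positive radial solution of `Δφ = φ` on `ℝ^N`. -/
def eigenfun (N : ℕ) (x : Space N) : ℝ := besselSeries (N / 2) (‖x‖ ^ 2 / 4)

theorem contDiff_eigenfun {N : ℕ} (hN : 1 ≤ N) : ContDiff ℝ ∞ (eigenfun N) :=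
  (contDiff_besselSeries (by have : (1 : ℝ) ≤ N := by exact_mod_cast hN
                             positivity)).comp
    ((contDiff_norm_sq ℝ).div_const 4)

theorem eigenfun_pos {N : ℕ} (hN : 1 ≤ N) (x : Space N) : 0 < eigenfun N x :=
  besselSeries_pos (by have : (1 : ℝ) ≤ N := by exact_mod_cast hN
                       positivity) (by positivity)

/-- The Laplacian of a function on `ℝ^N`, as the sum of its pure second derivatives in the
coordinate directions. -/
def lap {N : ℕ} (ψ : Space N → ℝ) (x : Space N) : ℝ :=
  ∑ i, fderiv ℝ (fun y => fderiv ℝ ψ y (EuclideanSpace.single i 1)) x (EuclideanSpace.single i 1)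

theorem hasFDerivAt_besselSeries_norm {N : ℕ} {α : ℝ} (hα : 0 < α) (x : Space N) :
    HasFDerivAt (fun y : Space N => besselSeries α (‖y‖ ^ 2 / 4))
      ((besselSeries (α + 1) (‖x‖ ^ 2 / 4) / 2) • innerSL ℝ x) x := by
  have h1 := ((hasStrictFDerivAt_norm_sq x).hasFDerivAt).mul_const (1 / 4 : ℝ)
  have h2 := (hasDerivAt_besselSeries hα (‖x‖ ^ 2 * (1 / 4))).comp_hasFDerivAt x h1
  have e : ∀ y : Space N, ‖y‖ ^ 2 / 4 = ‖y‖ ^ 2 * (1 / 4) := fun y => by ring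
  simp only [e]
  refine h2.congr_fderiv ?_
  ext y
  simp
  ring

theorem lap_eigenfun {N : ℕ} (hN : 1 ≤ N) (x : Space N) :
    lap (eigenfun N) x = eigenfun N x := by
  have hα : (0 : ℝ) < (N : ℝ) / 2 := by
    have : (1 : ℝ) ≤ N := by exact_mod_cast hN
    positivity
  set α : ℝ := (N : ℝ) / 2 with hα'
  have hterm : ∀ i : Fin N, fderiv ℝ (fun y => fderiv ℝ (eigenfun N) y
      (EuclideanSpace.single i 1)) x (EuclideanSpace.single i 1)
      = besselSeries (α + 2) (‖x‖ ^ 2 / 4) * (x i) ^ 2 / 4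
        + besselSeries (α + 1) (‖x‖ ^ 2 / 4) / 2 := by
    intro i
    have h1 : (fun y => fderiv ℝ (eigenfun N) y (EuclideanSpace.single i 1))
        = fun y => besselSeries (α + 1) (‖y‖ ^ 2 / 4) * (y i / 2) := by
      ext y
      rw [show eigenfun N = fun y : Space N => besselSeries α (‖y‖ ^ 2 / 4) from rfl,
        (hasFDerivAt_besselSeries_norm hα y).fderiv]
      simp [EuclideanSpace.inner_single_right]
      ring
    have h2 : HasFDerivAt (fun y : Space N => y i / 2)
        ((1 / 2 : ℝ) • (EuclideanSpace.proj i : Space N →L[ℝ] ℝ)) x := by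
      have := ((EuclideanSpace.proj i : Space N →L[ℝ] ℝ).hasFDerivAt
        (x := x)).const_smul (1 / 2 : ℝ)
      refine this.congr_of_eventuallyEq (Filter.Eventually.of_forall fun y => ?_)
      simp; ring
    have h3 := (hasFDerivAt_besselSeries_norm (by linarith : 0 < α + 1) x).mul h2
    rw [h1, HasFDerivAt.fderiv (f := fun y : Space N =>
      besselSeries (α + 1) (‖y‖ ^ 2 / 4) * (y i / 2)) h3]
    simp [EuclideanSpace.inner_single_right]
    rw [show α + 1 + 1 = α + 2 by ring]
    ring
  unfold lap
  rw [Finset.sum_congr rfl fun i _ => hterm i, Finset.sum_add_distrib, ← Finset.sum_div,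
    ← Finset.mul_sum, ← EuclideanSpace.real_norm_sq_eq]
  simp only [Finset.sum_const, Finset.card_univ, Fintype.card_fin, nsmul_eq_mul]
  rw [eigenfun, ← besselSeries_ode hα]
  rw [show (N : ℝ) = 2 * α by rw [hα']; ring]
  ring

/-! ### Integrals of the eigenfunction over balls -/

theorem one_add_rpow_le_exp {β z : ℝ} (hβ : 0 ≤ β) (hz : 0 ≤ z) :
    (1 + z) ^ β ≤ (2 * (β + 1)) ^ β * Real.exp (z / 2) := by
  have h1 : 1 + z ≤ 2 * (β + 1) * Real.exp (z / (2 * (β + 1))) := by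
    have := Real.add_one_le_exp (z / (2 * (β + 1)))
    calc 1 + z ≤ 2 * (β + 1) * (z / (2 * (β + 1)) + 1) := by
          field_simp; linarith
      _ ≤ _ := by gcongr
  calc (1 + z) ^ β ≤ (2 * (β + 1) * Real.exp (z / (2 * (β + 1)))) ^ β := by gcongr
    _ = (2 * (β + 1)) ^ β * Real.exp (z / (2 * (β + 1)) * β) := by
        rw [Real.mul_rpow (by positivity) (Real.exp_pos _).le, Real.exp_mul]
    _ ≤ _ := by
        gcongr
        rw [div_mul_eq_mul_div, div_le_div_iff₀ (by positivity) (by positivity)]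
        nlinarith

/-- Powers of either sign at `y ≤ ρ` are bounded by those at `ρ`, with a loss depending only on
the distance `ρ - y`. -/
theorem one_add_rpow_le_mul {γ y ρ : ℝ} (hy : 0 ≤ y) (hyρ : y ≤ ρ) :
    (1 + y) ^ γ ≤ (1 + ρ) ^ γ * (1 + (ρ - y)) ^ |γ| := by
  have hρ : 0 ≤ ρ := hy.trans hyρ
  rcases le_total 0 γ with h | h
  · calc (1 + y) ^ γ ≤ (1 + ρ) ^ γ := by gcongr
      _ ≤ _ := le_mul_of_one_le_right (by positivity)
        (Real.one_le_rpow (by linarith) (abs_nonneg _))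
  · have h1 : (1 + ρ) ^ (-γ) ≤ (1 + y) ^ (-γ) * (1 + (ρ - y)) ^ (-γ) := by
      rw [← Real.mul_rpow (by linarith) (by linarith)]
      apply Real.rpow_le_rpow (by linarith) _ (by linarith)
      nlinarith
    rw [abs_of_nonpos h]
    have p1 : 0 < (1 + ρ) ^ γ := Real.rpow_pos_of_pos (by linarith) _
    have p2 : 0 < (1 + y) ^ γ := Real.rpow_pos_of_pos (by linarith) _
    rw [Real.rpow_neg (by linarith), Real.rpow_neg (by linarith : 0 ≤ 1 + y)] at h1
    rw [inv_mul_eq_div, inv_eq_one_div, div_le_div_iff₀ p1 p2] at h1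
    linarith

/-- The integral of `φ^s` over a ball, `φ` the eigenfunction, is dominated by the boundary layer of
width one: the integrand in polar coordinates is at most a power of `1 + y` times `e^{sy}`. -/
theorem exists_integral_eigenfun_rpow_le {N : ℕ} (hN : 1 ≤ N) {s : ℝ} (hs : 1 < s) :
    ∃ C : ℝ, 0 < C ∧ ∀ ρ : ℝ, 0 ≤ ρ →
      ∫ x in Metric.closedBall (0 : Space N) ρ, eigenfun N x ^ s
        ≤ C * ((1 + ρ) ^ (((N : ℝ) - 1) * (1 - s / 2)) * Real.exp (s * ρ)) := by
  obtain ⟨n, rfl⟩ : ∃ n, N = n + 1 := ⟨N - 1, by omega⟩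
  obtain ⟨C, hC0, hC⟩ := exists_besselSeries_le n
  have : Nontrivial (Space (n + 1)) :=
    Module.nontrivial_of_finrank_pos (R := ℝ) (by simp)
  set γ : ℝ := (((n + 1 : ℕ) : ℝ) - 1) * (1 - s / 2) with hγ
  have hγn : γ = n * (1 - s / 2) := by rw [hγ]; push_cast; ring
  set v : ℝ := (volume : Measure (Space (n + 1))).real (Metric.ball 0 1) with hv
  have hv0 : 0 ≤ v := measureReal_nonneg
  set B : ℝ := C ^ s * (2 * (|γ| + 1)) ^ |γ| with hB
  have hB0 : 0 < B := by positivity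
  set G : ℝ → ℝ := fun y => besselSeries ((n + 1) / 2) (y ^ 2 / 4) with hG
  have hα : (0 : ℝ) < ((n : ℝ) + 1) / 2 := by positivity
  have hGpos : ∀ y, 0 < G y := fun y => besselSeries_pos hα (by positivity)
  have hGcont : Continuous G :=
    (contDiff_besselSeries hα).continuous.comp (by fun_prop)
  refine ⟨(n + 1) * v * (B / (s - 1 / 2)) + 1, by
    have : 0 < s - 1 / 2 := by linarith
    positivity, fun ρ hρ => ?_⟩
  have hs2 : 0 < s - 1 / 2 := by linarith
  -- passage to polar coordinates
  have e1 : ∫ x in Metric.closedBall (0 : Space (n + 1)) ρ, eigenfun (n + 1) x ^ s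
      = (n + 1) * v * ∫ y in Ioc 0 ρ, y ^ n * G y ^ s := by
    rw [← integral_indicator Metric.isClosed_closedBall.measurableSet]
    have : (Metric.closedBall (0 : Space (n + 1)) ρ).indicator (fun x => eigenfun (n + 1) x ^ s)
        = fun x => (Iic ρ).indicator (fun y => G y ^ s) ‖x‖ := by
      ext x
      by_cases hx : ‖x‖ ≤ ρ
      · rw [indicator_of_mem (by simpa using hx), indicator_of_mem (by simpa using hx)]
        simp [eigenfun, hG]
      · rw [indicator_of_notMem (by simpa using hx), indicator_of_notMem (by simpa using hx)]
    rw [this, integral_fun_norm_addHaar]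
    simp only [finrank_euclideanSpace, Fintype.card_fin, smul_eq_mul, nsmul_eq_mul,
      Nat.add_sub_cancel]
    rw [← hv]
    push_cast
    rw [mul_assoc]
    congr 2
    rw [← Ioi_inter_Iic, ← setIntegral_indicator measurableSet_Iic]
    congr 1
    ext y
    by_cases hy : y ∈ Iic ρ
    · rw [indicator_of_mem hy, indicator_of_mem hy]
    · rw [indicator_of_notMem hy, indicator_of_notMem hy, mul_zero]
  have hbound : ∀ y ∈ Ioc 0 ρ, y ^ n * G y ^ s
      ≤ B * ((1 + ρ) ^ γ * Real.exp (ρ / 2)) * Real.exp ((s - 1 / 2) * y) := by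
    intro y hy
    have hy0 : 0 ≤ y := hy.1.le
    have hGy : G y ^ s ≤ C ^ s * ((1 + y) ^ (-((n : ℝ) / 2) * s) * Real.exp (y * s)) := by
      calc G y ^ s ≤ (C * ((1 + y) ^ (-((n : ℝ) / 2)) * Real.exp y)) ^ s := by
            have := hC y hy0
            have := (hGpos y).le
            gcongr
        _ = _ := by
            rw [Real.mul_rpow hC0.le (by positivity), Real.mul_rpow (by positivity)
              (Real.exp_pos _).le, ← Real.rpow_mul (by positivity), Real.exp_mul]
    have hyn : y ^ n ≤ (1 + y) ^ (n : ℝ) := by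
      rw [Real.rpow_natCast]; gcongr; linarith
    have hyy : (1 + y) ^ (n : ℝ) * (1 + y) ^ (-((n : ℝ) / 2) * s) = (1 + y) ^ γ := by
      rw [← Real.rpow_add (by linarith), hγn]; congr 1; ring
    have hγy := one_add_rpow_le_mul (γ := γ) hy0 hy.2
    have hexp := one_add_rpow_le_exp (abs_nonneg γ) (sub_nonneg.mpr hy.2)
    have hGs : 0 ≤ G y ^ s := Real.rpow_nonneg (hGpos y).le _
    calc y ^ n * G y ^ s
        ≤ (1 + y) ^ (n : ℝ) * (C ^ s * ((1 + y) ^ (-((n : ℝ) / 2) * s) * Real.exp (y * s))) := by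
          gcongr
      _ = C ^ s * (1 + y) ^ γ * Real.exp (y * s) := by rw [← hyy]; ring
      _ ≤ C ^ s * ((1 + ρ) ^ γ * ((2 * (|γ| + 1)) ^ |γ| * Real.exp ((ρ - y) / 2)))
            * Real.exp (y * s) := by
          gcongr
          exact hγy.trans (by gcongr)
      _ = B * (1 + ρ) ^ γ * (Real.exp ((ρ - y) / 2) * Real.exp (y * s)) := by
          rw [hB]; ring
      _ = B * (1 + ρ) ^ γ * (Real.exp (ρ / 2) * Real.exp ((s - 1 / 2) * y)) := by
          rw [← Real.exp_add, ← Real.exp_add]; congr 2; ring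
      _ = _ := by ring
  have hexpint : ∫ y in Ioc 0 ρ, Real.exp ((s - 1 / 2) * y)
      ≤ Real.exp ((s - 1 / 2) * ρ) / (s - 1 / 2) := by
    rw [← intervalIntegral.integral_of_le hρ]
    have hd : ∀ y ∈ uIcc 0 ρ, HasDerivAt (fun y => Real.exp ((s - 1 / 2) * y) / (s - 1 / 2))
        (Real.exp ((s - 1 / 2) * y)) y := by
      intro y _
      have := (((hasDerivAt_id y).const_mul (s - 1 / 2)).exp).div_const (s - 1 / 2)
      refine this.congr_deriv ?_
      rw [mul_one, mul_div_cancel_right₀ _ hs2.ne']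
      rfl
    rw [intervalIntegral.integral_eq_sub_of_hasDerivAt hd
      (Continuous.intervalIntegrable (by fun_prop) _ _)]
    have : 0 < Real.exp ((s - 1 / 2) * 0) / (s - 1 / 2) := by positivity
    linarith
  have hint : ∫ y in Ioc 0 ρ, y ^ n * G y ^ s
      ≤ B * ((1 + ρ) ^ γ * Real.exp (ρ / 2)) * (Real.exp ((s - 1 / 2) * ρ) / (s - 1 / 2)) := by
    calc ∫ y in Ioc 0 ρ, y ^ n * G y ^ s
        ≤ ∫ y in Ioc 0 ρ, B * ((1 + ρ) ^ γ * Real.exp (ρ / 2)) * Real.exp ((s - 1 / 2) * y) := by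
          refine setIntegral_mono_on ?_ ?_ measurableSet_Ioc hbound
          · refine (Continuous.integrableOn_Icc ?_).mono_set Ioc_subset_Icc_self
            exact (continuous_pow n).mul
              (hGcont.rpow_const fun y => Or.inl (hGpos y).ne')
          · exact (Continuous.integrableOn_Icc (by fun_prop)).mono_set Ioc_subset_Icc_self
      _ ≤ _ := by
          rw [integral_const_mul]
          gcongr
  have hfin : Real.exp (ρ / 2) * Real.exp ((s - 1 / 2) * ρ) = Real.exp (s * ρ) := by
    rw [← Real.exp_add]; congr 1; ring
  rw [e1]
  calc (n + 1) * v * ∫ y in Ioc 0 ρ, y ^ n * G y ^ s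
      ≤ (n + 1) * v * (B * ((1 + ρ) ^ γ * Real.exp (ρ / 2))
          * (Real.exp ((s - 1 / 2) * ρ) / (s - 1 / 2))) := by gcongr
    _ = (n + 1) * v * (B / (s - 1 / 2)) * ((1 + ρ) ^ γ * Real.exp (s * ρ)) := by
        rw [← hfin]; ring
    _ ≤ _ := by
        gcongr; linarith

/-! ### Testing the equation with functions of the space variable -/

/-- The pairing `∫ h ψ dx` of `h ∈ L²` with a test function `ψ`. -/
def pair {N : ℕ} (h : L2 N) (ψ : Space N → ℝ) : ℝ := ∫ x, h x * ψ x

/-- The nonlinear term of the equation tested with the time-independent function `ψ`. -/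
def source {N : ℕ} (p q : ℝ) (T : ℝ≥0∞) (u : ℝ → H1 N) (ψ : Space N → ℝ) (s : ℝ) : ℝ :=
  nonlinearTerm p q T u (fun z => ψ z.1) s

theorem memLp_two_of_hasCompactSupport {N : ℕ} {ψ : Space N → ℝ} (hψ : Continuous ψ)
    (hc : HasCompactSupport ψ) : MemLp ψ 2 (volume : Measure (Space N)) :=
  hψ.memLp_of_hasCompactSupport hc

theorem contDiff_fderiv_apply {N : ℕ} {ψ : Space N → ℝ} (hψ : ContDiff ℝ ∞ ψ) (e : Space N) :
    ContDiff ℝ ∞ fun x => fderiv ℝ ψ x e :=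
  (hψ.fderiv_right (m := ∞) (by simp)).clm_apply contDiff_const

/-- Integration by parts against the weak gradient. -/
theorem integral_inner_gradient {N : ℕ} {v : L2 N} {w : L2Vec N} (h : IsWeakGradient v w)
    {ψ : Space N → ℝ} (hψ : ContDiff ℝ ∞ ψ) (hc : HasCompactSupport ψ) :
    ∫ x, inner ℝ (w x) (gradient ψ x) = -pair v (lap ψ) := by
  set e : Fin N → Space N := fun i => EuclideanSpace.single i 1 with he
  have hs : ∀ i, ContDiff ℝ ∞ fun x => fderiv ℝ ψ x (e i) := fun i =>
    contDiff_fderiv_apply hψ (e i)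
  have hcs : ∀ i, HasCompactSupport fun x => fderiv ℝ ψ x (e i) := fun i =>
    hc.fderiv_apply ℝ (e i)
  have h1 : ∀ x, inner ℝ (w x) (gradient ψ x) = ∑ i, inner ℝ (w x) (e i) * fderiv ℝ ψ x (e i) := by
    intro x
    rw [← (EuclideanSpace.basisFun (Fin N) ℝ).sum_inner_mul_inner]
    refine Finset.sum_congr rfl fun i _ => ?_
    rw [EuclideanSpace.basisFun_apply]
    congr 1
    rw [real_inner_comm, gradient, InnerProductSpace.toDual_symm_apply]
  have i1 : ∀ i, Integrable (fun x => inner ℝ (w x) (e i) * fderiv ℝ ψ x (e i)) volume := by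
    intro i
    exact MemLp.integrable_mul (p := 2) (q := 2) ((Lp.memLp w).inner_const (e i))
      (memLp_two_of_hasCompactSupport (hs i).continuous (hcs i))
  have i2 : ∀ i, Integrable (fun x => v x * fderiv ℝ (fun y => fderiv ℝ ψ y (e i)) x (e i))
      volume := by
    intro i
    exact MemLp.integrable_mul (p := 2) (q := 2) (Lp.memLp v)
      (memLp_two_of_hasCompactSupport (contDiff_fderiv_apply (hs i) (e i)).continuous
        ((hcs i).fderiv_apply ℝ (e i)))
  simp only [h1, pair, lap, Finset.mul_sum]
  rw [integral_finsetSum _ fun i _ => i1 i, integral_finsetSum _ fun i _ => i2 i,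
    ← Finset.sum_neg_distrib]
  refine Finset.sum_congr rfl fun i _ => ?_
  rw [h _ (hs i) (hcs i) (e i), neg_neg]

theorem Icc_subset_timeInterval {T : ℝ≥0∞} {b : ℝ} (hbT : ENNReal.ofReal b < T) :
    Icc 0 b ⊆ timeInterval T :=
  fun _ ht => ⟨ht.1, (ENNReal.ofReal_le_ofReal ht.2).trans_lt hbT⟩

section
variable {N : ℕ} {m p q ε R : ℝ} {f g : Space N → ℝ} {T : ℝ≥0∞} {u : ℝ → H1 N}

/-- The weak formulation for time-independent test functions. -/
theorem IsEnergySolution.weak_form_static (sol : IsEnergySolution m p q ε f g T u) {b : ℝ}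
    (hb : 0 ≤ b) (hbT : ENNReal.ofReal b < T) {ψ : Space N → ℝ} (hψ : ContDiff ℝ ∞ ψ)
    (hc : HasCompactSupport ψ) {t : ℝ} (ht : t ∈ Icc 0 b) :
    IntervalIntegrable (source p q T u ψ) volume 0 t ∧
    pair (timeDeriv T u t) ψ - pair (timeDeriv T u 0) ψ
      = (∫ s in (0 : ℝ)..t, s ^ (2 * m) * pair (u s).fn (lap ψ))
        + ∫ s in (0 : ℝ)..t, source p q T u ψ s := by
  obtain ⟨r, hr1, hr2⟩ := ENNReal.lt_iff_exists_nnreal_btwn.mp hbT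
  have hbr : b < r := by
    rw [← ENNReal.ofReal_coe_nnreal, ENNReal.ofReal_lt_ofReal_iff_of_nonneg hb] at hr1
    exact hr1
  -- a cutoff in time, equal to one near `[0, b]`
  let η : ContDiffBump (0 : ℝ) := ⟨(b + r) / 2, r, by linarith, by linarith⟩
  have hη : ∀ s ∈ Icc 0 b, (η : ℝ → ℝ) =ᶠ[nhds s] 1 := by
    intro s hs
    refine η.eventuallyEq_one_of_mem_ball ?_
    rw [mem_ball_zero_iff, Real.norm_eq_abs, abs_of_nonneg hs.1]
    change s < (b + r) / 2
    linarith [hs.2]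
  have hη1 : ∀ s ∈ Icc 0 b, η s = 1 := fun s hs => (hη s hs).eq_of_nhds
  have htest : IsTestFunction T fun z : Space N × ℝ => η z.2 * ψ z.1 := by
    refine ⟨(η.contDiff.comp contDiff_snd).mul (hψ.comp contDiff_fst), ?_, ?_⟩
    · refine HasCompactSupport.intro (hc.isCompact.prod (isCompact_closedBall (0 : ℝ) r)) ?_
      intro z hz
      by_contra hne
      apply hz
      refine ⟨subset_tsupport _ (right_ne_zero_of_mul hne), ?_⟩
      have := subset_tsupport _ (show z.2 ∈ Function.support η from left_ne_zero_of_mul hne)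
      rwa [η.tsupport_eq] at this
    · have hcl : IsClosed {z : Space N × ℝ | z.2 ≤ r} := isClosed_le continuous_snd continuous_const
      have hsub : tsupport (fun z : Space N × ℝ => η z.2 * ψ z.1) ⊆ {z | z.2 ≤ r} := by
        refine closure_minimal (fun z hz => ?_) hcl
        have := subset_tsupport _ (show z.2 ∈ Function.support η from left_ne_zero_of_mul hz)
        rw [η.tsupport_eq, mem_closedBall_zero_iff, Real.norm_eq_abs] at this
        exact (le_abs_self _).trans this
      intro z hz
      have : z.2 ≤ r := hsub hz
      refine (ENNReal.ofReal_le_ofReal this).trans_lt ?_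
      rwa [ENNReal.ofReal_coe_nnreal]
  have htT := Icc_subset_timeInterval hbT ht
  have hsrc : ∀ s ∈ Icc 0 b, nonlinearTerm p q T u (fun z => η z.2 * ψ z.1) s
      = source p q T u ψ s := by
    intro s hs
    simp [source, nonlinearTerm, hη1 s hs]
  have hIcc : uIcc 0 t ⊆ Icc 0 b := by
    rw [uIcc_of_le ht.1]; exact Icc_subset_Icc le_rfl ht.2
  have hw := sol.weak_form _ htest t htT
  have hi := sol.nonlinear_integrable _ htest t htT
  refine ⟨hi.congr fun s hs => hsrc s (hIcc (uIoc_subset_uIcc hs)), ?_⟩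
  rw [intervalIntegral.integral_congr (g := source p q T u ψ) fun s hs => hsrc s (hIcc hs)] at hw
  have e1 : ∫ s in (0 : ℝ)..t, ∫ x, timeDeriv T u s x
      * deriv (fun τ => η τ * ψ x) s = 0 := by
    rw [intervalIntegral.integral_congr (g := fun _ => (0 : ℝ)) fun s hs => ?_]
    · simp
    have : ∀ x, deriv (fun τ => η τ * ψ x) s = 0 := by
      intro x
      have : (fun τ => η τ * ψ x) =ᶠ[nhds s] fun _ => ψ x := by
        filter_upwards [hη s (hIcc hs)] with τ hτ
        simp [hτ]
      rw [this.deriv_eq, deriv_const]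
    simp [this]
  have e2 : ∫ s in (0 : ℝ)..t, s ^ (2 * m)
        * ∫ x, inner ℝ ((u s).grad x) (gradient (fun y => η s * ψ y) x)
      = -∫ s in (0 : ℝ)..t, s ^ (2 * m) * pair (u s).fn (lap ψ) := by
    rw [← intervalIntegral.integral_neg]
    refine intervalIntegral.integral_congr fun s hs => ?_
    have : (fun y => η s * ψ y) = ψ := by ext y; rw [hη1 s (hIcc hs), one_mul]
    simp only [this]
    rw [integral_inner_gradient (v := (u s).fn) (w := (u s).grad) (u s).2 hψ hc]
    ring
  simp only [hη1 t ht, hη1 0 ⟨le_rfl, hb⟩, one_mul] at hw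
  rw [e1, e2] at hw
  unfold pair
  unfold pair at hw
  linarith

theorem IsEnergySolution.hasDerivWithinAt_fn (sol : IsEnergySolution m p q ε f g T u) {t : ℝ}
    (ht : t ∈ timeInterval T) :
    HasDerivWithinAt (fun s => (u s).fn) (timeDeriv T u t) (timeInterval T) t :=
  (sol.contDiff_L2.differentiableOn (by simp) t ht).hasDerivWithinAt

theorem IsEnergySolution.hasDerivWithinAt_pair (sol : IsEnergySolution m p q ε f g T u) {b : ℝ}
    (hbT : ENNReal.ofReal b < T) {ψ : Space N → ℝ} (hψ : Continuous ψ)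
    (hc : HasCompactSupport ψ) {t : ℝ} (ht : t ∈ Icc 0 b) :
    HasDerivWithinAt (fun s => pair (u s).fn ψ) (pair (timeDeriv T u t) ψ) (Icc 0 b) t := by
  have hL := memLp_two_of_hasCompactSupport hψ hc
  have hpair : ∀ h : L2 N, innerSL ℝ (hL.toLp ψ) h = pair h ψ := by
    intro h
    rw [innerSL_apply_apply, L2.inner_def, pair]
    refine integral_congr_ae ?_
    filter_upwards [hL.coeFn_toLp] with x hx
    simp [hx]
  have h1 := (sol.hasDerivWithinAt_fn (Icc_subset_timeInterval hbT ht)).mono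
    (Icc_subset_timeInterval hbT)
  have h2 := (innerSL ℝ (hL.toLp ψ)).hasFDerivAt.comp_hasDerivWithinAt t h1
  rw [hpair] at h2
  refine h2.congr (fun s _ => (hpair _).symm) (hpair _).symm

theorem xi_mono (hm : 0 ≤ m) {s t : ℝ} (hs : 0 ≤ s) (hst : s ≤ t) : xi m s ≤ xi m t := by
  unfold xi; gcongr

/-- The time derivative of a solution inherits the support of the solution, being a limit of
difference quotients from the left. -/
theorem IsEnergySolution.timeDeriv_eq_zero (sol : IsEnergySolution m p q ε f g T u) (hm : 0 ≤ m)
    (hsupp : SupportedInCone m R T u) {t : ℝ} (ht0 : 0 < t) (ht : t ∈ timeInterval T) :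
    ∀ᵐ x : Space N, xi m t + R < ‖x‖ → timeDeriv T u t x = 0 := by
  set S : Set (Space N) := {x | xi m t + R < ‖x‖} with hS
  have hSm : MeasurableSet S := measurableSet_lt measurable_const measurable_norm
  set P := LpToLpRestrictCLM (Space N) ℝ ℝ (volume : Measure (Space N)) 2 S with hP
  have hsub : Icc 0 t ⊆ timeInterval T := Icc_subset_timeInterval ht.2
  have hzero : ∀ s ∈ Icc 0 t, P (u s).fn = 0 := by
    intro s hs
    rw [Lp.eq_zero_iff_ae_eq_zero]
    refine (LpToLpRestrictCLM_coeFn ℝ S _).trans ?_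
    rw [Filter.EventuallyEq, ae_restrict_iff' hSm]
    filter_upwards [hsupp s (hsub hs)] with x hx hxS
    have hxS' : xi m t + R < ‖x‖ := hxS
    exact hx (by linarith [xi_mono hm hs.1 hs.2])
  have h1 := P.hasFDerivAt.comp_hasDerivWithinAt t ((sol.hasDerivWithinAt_fn ht).mono hsub)
  have h2 : HasDerivWithinAt (P ∘ fun s => (u s).fn) 0 (Icc 0 t) t :=
    (hasDerivWithinAt_const t (Icc 0 t) 0).congr (fun s hs => hzero s hs)
      (hzero t ⟨ht0.le, le_rfl⟩)
  have h3 : P (timeDeriv T u t) = 0 :=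
    ((uniqueDiffOn_Icc ht0) t ⟨ht0.le, le_rfl⟩).eq_deriv _ h1 h2
  rw [Lp.eq_zero_iff_ae_eq_zero] at h3
  have h4 := (LpToLpRestrictCLM_coeFn ℝ S (timeDeriv T u t)).symm.trans h3
  rwa [Filter.EventuallyEq, ae_restrict_iff' hSm] at h4

/-- By Fubini, local space-time integrability gives local integrability in space at almost every
time. -/
theorem MemLpLoc.ae_integrableOn {r : ℝ} (hr : 0 < r) {h : ℝ → L2 N} (hh : MemLpLoc r T h) {b : ℝ}
    (hbT : ENNReal.ofReal b < T) (ρ : ℝ) :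
    ∀ᵐ s ∂(volume.restrict (Ioc 0 b)),
      IntegrableOn (fun x => |h s x| ^ r) (Metric.closedBall 0 ρ) := by
  obtain ⟨H, hH, hK⟩ := hh
  have hU : Ioc 0 b ⊆ ⋃ n : ℕ, Icc (1 / ((n : ℝ) + 1)) b := by
    intro s hs
    obtain ⟨n, hn⟩ := exists_nat_one_div_lt hs.1
    exact mem_iUnion.mpr ⟨n, hn.le, hs.2⟩
  refine ae_restrict_of_ae_restrict_of_subset hU ?_
  rw [ae_restrict_iUnion_iff]
  intro n
  have hn : (0 : ℝ) < 1 / ((n : ℝ) + 1) := by positivity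
  have hmem := hK (Metric.closedBall 0 ρ ×ˢ Icc (1 / ((n : ℝ) + 1)) b)
    ((isCompact_closedBall 0 ρ).prod isCompact_Icc) (fun z hz =>
      ⟨hn.trans_le hz.2.1, (ENNReal.ofReal_le_ofReal hz.2.2).trans_lt hbT⟩)
  have hint := hmem.integrable_norm_rpow (by simpa using hr) ENNReal.ofReal_ne_top
  rw [ENNReal.toReal_ofReal hr.le, Measure.volume_eq_prod, ← Measure.prod_restrict] at hint
  filter_upwards [hint.prod_left_ae, ae_restrict_mem measurableSet_Icc] with s hs hsm
  refine Integrable.congr hs ?_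
  filter_upwards [ae_restrict_of_ae (hH s (hn.trans_le hsm.1)
    ((ENNReal.ofReal_le_ofReal hsm.2).trans_lt hbT))] with x hx
  rw [← hx, Real.norm_eq_abs]

/-- Hölder's inequality for a function supported in a ball. -/
theorem integral_mul_rpow_le {r : ℝ} (hr : 1 < r) {h ψ φ : Space N → ℝ} {ρ : ℝ}
    (hh : AEStronglyMeasurable h volume)
    (hint : IntegrableOn (fun x => |h x| ^ r) (Metric.closedBall 0 ρ))
    (hsupp : ∀ᵐ x, ρ < ‖x‖ → h x = 0) (hφ : Continuous φ) (hφ0 : ∀ x, 0 ≤ φ x)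
    (hψ : ∀ x ∈ Metric.closedBall (0 : Space N) ρ, ψ x = φ x) (h0 : 0 ≤ ∫ x, h x * ψ x) :
    (∫ x, h x * ψ x) ^ r ≤ (∫ x in Metric.closedBall 0 ρ, |h x| ^ r)
      * (∫ x in Metric.closedBall 0 ρ, φ x ^ (r / (r - 1))) ^ (r - 1) := by
  set B := Metric.closedBall (0 : Space N) ρ with hB
  have hr0 : 0 < r := by linarith
  have hr1 : 0 < r - 1 := by linarith
  have hconj : r.HolderConjugate (r / (r - 1)) := Real.HolderConjugate.conjExponent hr
  have hr' : 0 < r / (r - 1) := by positivity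
  have e1 : ∫ x, h x * ψ x = ∫ x in B, h x * φ x := by
    rw [← setIntegral_eq_integral_of_ae_compl_eq_zero (s := B)]
    · exact setIntegral_congr_fun Metric.isClosed_closedBall.measurableSet
        fun x hx => by simp only [hψ x hx]
    · filter_upwards [hsupp] with x hx hxB
      rw [hx (by simpa [hB] using hxB), zero_mul]
  have e2 : ∫ x in B, h x * φ x ≤ ∫ x in B, |h x| * φ x := by
    refine (le_abs_self _).trans (abs_integral_le_integral_abs.trans (le_of_eq ?_))
    congr 1; ext x
    rw [abs_mul, abs_of_nonneg (hφ0 x)]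
  have m1 : MemLp (fun x => |h x|) (ENNReal.ofReal r) (volume.restrict B) := by
    have hm : AEStronglyMeasurable (fun x => |h x|) (volume.restrict B) := hh.restrict.norm
    rw [← integrable_norm_rpow_iff hm (by simpa using hr0) ENNReal.ofReal_ne_top,
      ENNReal.toReal_ofReal hr0.le]
    simpa using! hint
  have m2 : MemLp φ (ENNReal.ofReal (r / (r - 1))) (volume.restrict B) := by
    rw [← integrable_norm_rpow_iff hφ.aestronglyMeasurable (by simpa using hr')
      ENNReal.ofReal_ne_top, ENNReal.toReal_ofReal hr'.le]
    exact (Continuous.continuousOn (hφ.norm.rpow_const fun x => Or.inr hr'.le)).integrableOn_compact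
      (isCompact_closedBall 0 ρ)
  have e3 := integral_mul_le_Lp_mul_Lq_of_nonneg hconj
    (Filter.Eventually.of_forall fun x => abs_nonneg (h x)) (Filter.Eventually.of_forall hφ0) m1 m2
  have i1 : 0 ≤ ∫ x in B, |h x| ^ r := integral_nonneg fun x => by positivity
  have i2 : 0 ≤ ∫ x in B, φ x ^ (r / (r - 1)) :=
    integral_nonneg fun x => Real.rpow_nonneg (hφ0 x) _
  calc (∫ x, h x * ψ x) ^ r
      ≤ ((∫ x in B, |h x| ^ r) ^ (1 / r)
          * (∫ x in B, φ x ^ (r / (r - 1))) ^ (1 / (r / (r - 1)))) ^ r := by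
        refine Real.rpow_le_rpow h0 ?_ hr0.le
        rw [e1]; exact e2.trans e3
    _ = _ := by
        rw [Real.mul_rpow (by positivity) (by positivity), ← Real.rpow_mul i1,
          ← Real.rpow_mul i2]
        congr 2
        · rw [one_div_mul_cancel hr0.ne', Real.rpow_one]
        · field_simp

/-- The integrability of `G` excludes that the right-hand side is the junk value zero. -/
theorem setIntegral_le_integral_mul {G χ : Space N → ℝ} {ρ ρ' : ℝ} (hG : ∀ x, 0 ≤ G x)
    (hint : IntegrableOn G (Metric.closedBall 0 ρ')) (hχ : Continuous χ) (hχ0 : ∀ x, 0 ≤ χ x)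
    (hχ1 : ∀ x ∈ Metric.closedBall (0 : Space N) ρ, χ x = 1)
    (hsupp : Function.support χ ⊆ Metric.closedBall 0 ρ') :
    ∫ x in Metric.closedBall 0 ρ, G x ≤ ∫ x, G x * χ x := by
  have h1 : Integrable (fun x => G x * χ x) volume := by
    rw [← integrableOn_iff_integrable_of_support_subset (s := Metric.closedBall 0 ρ')]
    · exact hint.mul_continuousOn hχ.continuousOn (isCompact_closedBall 0 ρ')
    · exact (Function.support_mul_subset_right _ _).trans hsupp
  calc ∫ x in Metric.closedBall 0 ρ, G x = ∫ x in Metric.closedBall 0 ρ, G x * χ x :=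
        setIntegral_congr_fun Metric.isClosed_closedBall.measurableSet
          fun x hx => by simp only [hχ1 x hx, mul_one]
    _ ≤ ∫ x, G x * χ x := setIntegral_le_integral h1
        (Filter.Eventually.of_forall fun x => mul_nonneg (hG x) (hχ0 x))

theorem source_nonneg {ψ : Space N → ℝ} (hψ : ∀ x, 0 ≤ ψ x) (s : ℝ) :
    0 ≤ source p q T u ψ s :=
  integral_nonneg fun x => mul_nonneg (by positivity) (hψ x)

theorem lap_congr {ψ φ : Space N → ℝ} {x : Space N} (h : ψ =ᶠ[nhds x] φ) :
    lap ψ x = lap φ x := by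
  unfold lap
  refine Finset.sum_congr rfl fun i _ => ?_
  have : (fun y => fderiv ℝ ψ y (EuclideanSpace.single i 1))
      =ᶠ[nhds x] fun y => fderiv ℝ φ y (EuclideanSpace.single i 1) := by
    filter_upwards [h.fderiv (𝕜 := ℝ)] with y hy
    rw [hy]
  rw [this.fderiv_eq]

theorem pair_congr_of_support {h : L2 N} {ψ φ : Space N → ℝ} {ρ : ℝ}
    (hsupp : ∀ᵐ x, ρ < ‖x‖ → h x = 0) (hψ : ∀ x, ‖x‖ ≤ ρ → ψ x = φ x) :
    pair h ψ = pair h φ := by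
  refine integral_congr_ae ?_
  filter_upwards [hsupp] with x hx
  rcases le_or_gt ‖x‖ ρ with h' | h'
  · simp only [hψ x h']
  · simp only [hx h', zero_mul]

theorem pair_initial {h : L2 N} {f : Space N → ℝ} (hh : h =ᵐ[volume] fun x => ε * f x)
    (hf : tsupport f ⊆ Metric.closedBall 0 R) {ψ φ : Space N → ℝ}
    (hψ : ∀ x, ‖x‖ ≤ R → ψ x = φ x) : pair h ψ = ε * ∫ x, f x * φ x := by
  rw [pair, ← integral_const_mul]
  refine integral_congr_ae ?_
  filter_upwards [hh] with x hx
  rcases le_or_gt ‖x‖ R with h' | h'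
  · simp only [hψ x h', hx]; ring
  · have : f x = 0 := image_eq_zero_of_notMem_tsupport fun hmem => by
      have := hf hmem
      rw [mem_closedBall_zero_iff] at this
      linarith
    simp [hx, this]

/-- Reduction to ordinary differential inequalities. Here `U = ∫ u φ dx`, with `φ` the positive
eigenfunction, `F = ∫ u dx`, and `n` is the integral of the nonlinear term over `ℝ^N`; `V` and `W`
are the derivatives of `U` and `F`. -/
theorem IsEnergySolution.exists_scalar_reduction (sol : IsEnergySolution m p q ε f g T u)
    (hN : 1 ≤ N) (hm : 0 ≤ m) (hp : 1 < p) (hq : 1 < q) (hR : 0 < R)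
    (hf_supp : tsupport f ⊆ Metric.closedBall 0 R) (hg_supp : tsupport g ⊆ Metric.closedBall 0 R)
    (hsupp : SupportedInCone m R T u) {b : ℝ} (hb : 0 ≤ b) (hbT : ENNReal.ofReal b < T) :
    ∃ U V F W n : ℝ → ℝ,
      (∀ t ∈ Icc 0 b, HasDerivWithinAt U (V t) (Icc 0 b) t) ∧
      (∀ s ∈ Icc 0 b, ∀ t ∈ Icc s b, V s + ∫ r in s..t, r ^ (2 * m) * U r ≤ V t) ∧
      U 0 = ε * (∫ x, f x * eigenfun N x) ∧ V 0 = ε * (∫ x, g x * eigenfun N x) ∧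
      (∀ t ∈ Icc 0 b, HasDerivWithinAt F (W t) (Icc 0 b) t) ∧
      (∀ s ∈ Icc 0 b, ∀ t ∈ Icc s b, IntervalIntegrable n volume s t ∧
        W s + ∫ r in s..t, n r = W t) ∧
      F 0 = ε * (∫ x, f x * 1) ∧ W 0 = ε * (∫ x, g x * 1) ∧
      (∀ s, 0 ≤ n s) ∧
      ∀ᵐ s ∂(volume.restrict (Ioc 0 b)),
        (0 ≤ V s → V s ^ p ≤ n s *
          (∫ x in Metric.closedBall (0 : Space N) (xi m s + R),
            eigenfun N x ^ (p / (p - 1))) ^ (p - 1)) ∧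
        (0 ≤ F s → F s ^ q ≤ n s *
          (volume : Measure (Space N)).real (Metric.closedBall 0 (xi m s + R)) ^ (q - 1)) := by
  set ρ : ℝ := xi m b + R + 1 with hρ
  have hxi0 : ∀ s, 0 ≤ s → 0 ≤ xi m s := fun s hs => by unfold xi; positivity
  have hρ0 : 0 < ρ := by have := hxi0 b hb; linarith
  -- a cutoff in space, equal to one on a neighbourhood of the support of the solution
  let χ : ContDiffBump (0 : Space N) := ⟨ρ, ρ + 1, hρ0, by linarith⟩
  have hχs : ContDiff ℝ ∞ χ := χ.contDiff
  have hχc : HasCompactSupport χ := χ.hasCompactSupport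
  have hχ0 : ∀ x, 0 ≤ χ x := fun x => χ.nonneg
  have hχev : ∀ x : Space N, ‖x‖ < ρ → (χ : Space N → ℝ) =ᶠ[nhds x] 1 := fun x hx =>
    χ.eventuallyEq_one_of_mem_ball (by rwa [mem_ball_zero_iff])
  have hχ1 : ∀ x : Space N, ‖x‖ < ρ → χ x = 1 := fun x hx => (hχev x hx).eq_of_nhds
  have hχsupp : Function.support χ ⊆ Metric.closedBall (0 : Space N) (ρ + 1) :=
    (subset_tsupport _).trans χ.tsupport_eq.subset
  set ψ : Space N → ℝ := fun x => χ x * eigenfun N x with hψ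
  have hψs : ContDiff ℝ ∞ ψ := hχs.mul (contDiff_eigenfun hN)
  have hψc : HasCompactSupport ψ := hχc.mul_right
  have hψ1 : ∀ x : Space N, ‖x‖ < ρ → ψ x = eigenfun N x := fun x hx => by
    simp [hψ, hχ1 x hx]
  have hψ0 : ∀ x, 0 ≤ ψ x := fun x => mul_nonneg (hχ0 x) (eigenfun_pos hN x).le
  have hlapχ : ∀ x : Space N, ‖x‖ < ρ → lap χ x = 0 := by
    intro x hx
    rw [lap_congr (hχev x hx)]
    simp [lap]
  have hlapψ : ∀ x : Space N, ‖x‖ < ρ → lap ψ x = ψ x := by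
    intro x hx
    have : ψ =ᶠ[nhds x] eigenfun N := by
      filter_upwards [hχev x hx] with y hy
      simp [hψ, hy]
    rw [lap_congr this, lap_eigenfun hN, hψ1 x hx]
  have hle : ∀ s ∈ Icc 0 b, ∀ x : Space N, ‖x‖ ≤ xi m s + R → ‖x‖ < ρ := fun s hs x hx => by
    have := xi_mono hm hs.1 hs.2; linarith
  have hleR : ∀ x : Space N, ‖x‖ ≤ R → ‖x‖ < ρ := fun x hx => by
    have := hxi0 b hb; linarith
  have hsub := Icc_subset_timeInterval hbT
  have hFlap : ∀ s ∈ Icc 0 b, pair (u s).fn (lap χ) = 0 := by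
    intro s hs
    rw [pair_congr_of_support (hsupp s (hsub hs)) (φ := 0)
      fun x hx => hlapχ x (hle s hs x hx)]
    simp [pair]
  have hUlap : ∀ s ∈ Icc 0 b, pair (u s).fn (lap ψ) = pair (u s).fn ψ := fun s hs =>
    pair_congr_of_support (hsupp s (hsub hs)) fun x hx => hlapψ x (hle s hs x hx)
  have hUd : ∀ t ∈ Icc 0 b, HasDerivWithinAt (fun s => pair (u s).fn ψ)
      (pair (timeDeriv T u t) ψ) (Icc 0 b) t := fun t ht =>
    sol.hasDerivWithinAt_pair hbT hψs.continuous hψc ht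
  have hFd : ∀ t ∈ Icc 0 b, HasDerivWithinAt (fun s => pair (u s).fn χ)
      (pair (timeDeriv T u t) χ) (Icc 0 b) t := fun t ht =>
    sol.hasDerivWithinAt_pair hbT hχs.continuous hχc ht
  have hcontU : ContinuousOn (fun s => s ^ (2 * m) * pair (u s).fn ψ) (Icc 0 b) :=
    (Real.continuous_rpow_const (by positivity)).continuousOn.mul
      fun t ht => (hUd t ht).continuousWithinAt
  have huIcc : ∀ t ∈ Icc 0 b, uIcc 0 t ⊆ Icc 0 b := fun t ht => by
    rw [uIcc_of_le ht.1]; exact Icc_subset_Icc le_rfl ht.2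
  have hint : ∀ φ : Space N → ℝ, ContDiff ℝ ∞ φ → HasCompactSupport φ → ∀ s ∈ Icc 0 b,
      ∀ t ∈ Icc s b, IntervalIntegrable (source p q T u φ) volume s t := by
    intro φ hφ hφc s hs t ht
    exact (sol.weak_form_static hb hbT hφ hφc hs).1.symm.trans
      (sol.weak_form_static hb hbT hφ hφc ⟨hs.1.trans ht.1, ht.2⟩).1
  refine ⟨fun s => pair (u s).fn ψ, fun s => pair (timeDeriv T u s) ψ,
    fun s => pair (u s).fn χ, fun s => pair (timeDeriv T u s) χ, source p q T u χ,
    hUd, ?_, pair_initial sol.initial_fn hf_supp fun x hx => hψ1 x (hleR x hx),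
    pair_initial sol.initial_timeDeriv hg_supp fun x hx => hψ1 x (hleR x hx), hFd, ?_,
    pair_initial sol.initial_fn hf_supp fun x hx => hχ1 x (hleR x hx),
    pair_initial sol.initial_timeDeriv hg_supp fun x hx => hχ1 x (hleR x hx),
    source_nonneg hχ0, ?_⟩
  · intro s hs t ht
    have ht' : t ∈ Icc 0 b := ⟨hs.1.trans ht.1, ht.2⟩
    have h1 := sol.weak_form_static hb hbT hψs hψc hs
    have h2 := sol.weak_form_static hb hbT hψs hψc ht'
    have e : ∀ r ∈ Icc 0 b, ∫ s in (0 : ℝ)..r, s ^ (2 * m) * pair (u s).fn (lap ψ)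
        = ∫ s in (0 : ℝ)..r, s ^ (2 * m) * pair (u s).fn ψ := fun r hr =>
      intervalIntegral.integral_congr fun s' hs' => by
        simp only [hUlap s' (huIcc r hr hs')]
    rw [e s hs] at h1
    rw [e t ht'] at h2
    have i1 : ∀ r ∈ Icc 0 b, IntervalIntegrable (fun s => s ^ (2 * m) * pair (u s).fn ψ)
        volume 0 r := fun r hr => (hcontU.mono (huIcc r hr)).intervalIntegrable
    have a1 := intervalIntegral.integral_add_adjacent_intervals (i1 s hs)
      ((i1 s hs).symm.trans (i1 t ht'))
    have a2 := intervalIntegral.integral_add_adjacent_intervals h1.1 (h1.1.symm.trans h2.1)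
    have a3 : 0 ≤ ∫ r in s..t, source p q T u ψ r :=
      intervalIntegral.integral_nonneg ht.1 fun r _ => source_nonneg hψ0 r
    have := h1.2
    have := h2.2
    linarith
  · intro s hs t ht
    have ht' : t ∈ Icc 0 b := ⟨hs.1.trans ht.1, ht.2⟩
    have h1 := sol.weak_form_static hb hbT hχs hχc hs
    have h2 := sol.weak_form_static hb hbT hχs hχc ht'
    have e : ∀ r ∈ Icc 0 b, ∫ s in (0 : ℝ)..r, s ^ (2 * m) * pair (u s).fn (lap χ) = 0 := by
      intro r hr
      rw [intervalIntegral.integral_congr (g := fun _ => (0 : ℝ)) fun s' hs' => by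
        simp only [hFlap s' (huIcc r hr hs'), mul_zero]]
      simp
    rw [e s hs] at h1
    rw [e t ht'] at h2
    refine ⟨hint _ hχs hχc s hs t ht, ?_⟩
    have a2 := intervalIntegral.integral_add_adjacent_intervals h1.1 (h1.1.symm.trans h2.1)
    have := h1.2
    have := h2.2
    linarith
  · filter_upwards [sol.memLpLoc_fn.ae_integrableOn (by linarith) hbT (ρ + 1),
      sol.memLpLoc_timeDeriv.ae_integrableOn (by linarith) hbT (ρ + 1),
      ae_restrict_mem measurableSet_Ioc] with s hs1 hs2 hs
    have hs' : s ∈ Icc 0 b := ⟨hs.1.le, hs.2⟩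
    have hball : Metric.closedBall (0 : Space N) (xi m s + R) ⊆ Metric.closedBall 0 (ρ + 1) :=
      Metric.closedBall_subset_closedBall (by have := xi_mono hm hs.1.le hs.2; linarith)
    have hn := setIntegral_le_integral_mul (ρ := xi m s + R)
      (fun x => by positivity : ∀ x, 0 ≤ |timeDeriv T u s x| ^ p + |(u s).fn x| ^ q)
      (hs2.add hs1) hχs.continuous hχ0
      (fun x hx => hχ1 x (hle s hs' x (by simpa using hx))) hχsupp
    rw [integral_add (hs2.mono_set hball) (hs1.mono_set hball)] at hn
    have hn' : (∫ x in Metric.closedBall 0 (xi m s + R), |timeDeriv T u s x| ^ p)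
        + (∫ x in Metric.closedBall 0 (xi m s + R), |(u s).fn x| ^ q) ≤ source p q T u χ s := hn
    have p1 : 0 ≤ ∫ x in Metric.closedBall 0 (xi m s + R), |timeDeriv T u s x| ^ p :=
      integral_nonneg fun x => by positivity
    have p2 : 0 ≤ ∫ x in Metric.closedBall 0 (xi m s + R), |(u s).fn x| ^ q :=
      integral_nonneg fun x => by positivity
    constructor
    · intro hV
      refine (integral_mul_rpow_le hp (Lp.aestronglyMeasurable _) (hs2.mono_set hball)
        (sol.timeDeriv_eq_zero hm hsupp hs.1 (hsub hs')) (contDiff_eigenfun hN).continuous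
        (fun x => (eigenfun_pos hN x).le)
        (fun x hx => hψ1 x (hle s hs' x (by simpa using hx))) hV).trans ?_
      have : 0 ≤ ∫ x in Metric.closedBall (0 : Space N) (xi m s + R),
          eigenfun N x ^ (p / (p - 1)) :=
        integral_nonneg fun x => Real.rpow_nonneg (eigenfun_pos hN x).le _
      gcongr
      linarith
    · intro hF
      have := integral_mul_rpow_le hq (Lp.aestronglyMeasurable _) (hs1.mono_set hball)
        (hsupp s (hsub hs')) (φ := fun _ => 1) continuous_const (fun x => zero_le_one)
        (fun x hx => hχ1 x (hle s hs' x (by simpa using hx))) hF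
      simp only [Real.one_rpow, integral_const, smul_eq_mul, mul_one, measureReal_restrict_apply
        MeasurableSet.univ, univ_inter] at this
      refine this.trans ?_
      gcongr
      linarith

end

/-! ### The lifespan estimate -/

theorem rpow_le_of_between {k₁ k₂ S x : ℝ} (γ : ℝ) (hk₁ : 0 < k₁) (hk₂ : 0 < k₂) (hS : 0 < S)
    (h1 : k₁ * S ≤ x) (h2 : x ≤ k₂ * S) : x ^ γ ≤ (k₁ ^ γ + k₂ ^ γ) * S ^ γ := by
  have hx : 0 < x := lt_of_lt_of_le (by positivity) h1
  rw [add_mul, ← Real.mul_rpow hk₁.le hS.le, ← Real.mul_rpow hk₂.le hS.le]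
  have p1 : 0 ≤ (k₁ * S) ^ γ := by positivity
  have p2 : 0 ≤ (k₂ * S) ^ γ := by positivity
  rcases le_total 0 γ with h | h
  · have := Real.rpow_le_rpow hx.le h2 h
    linarith
  · have := Real.rpow_le_rpow_of_nonpos (by positivity) h1 h
    linarith

theorem xi_add_le {m R s : ℝ} (hm : 0 ≤ m) (hR : 0 ≤ R) (hs : 1 ≤ s) :
    1 + (xi m s + R) ≤ (1 / (m + 1) + 1 + R) * s ^ (m + 1) := by
  have h1 : 1 ≤ s ^ (m + 1) := Real.one_le_rpow hs (by linarith)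
  unfold xi
  have : s ^ (m + 1) / (m + 1) = 1 / (m + 1) * s ^ (m + 1) := by ring
  rw [this]
  nlinarith

theorem le_xi_add {m R s : ℝ} (hR : 0 ≤ R) :
    1 / (m + 1) * s ^ (m + 1) ≤ 1 + (xi m s + R) := by
  unfold xi
  have : s ^ (m + 1) / (m + 1) = 1 / (m + 1) * s ^ (m + 1) := by ring
  rw [this]
  linarith

theorem xi_nonneg {m s : ℝ} (hm : 0 ≤ m) (hs : 0 ≤ s) : 0 ≤ xi m s := by
  unfold xi; positivity

/-- Growth in time of the dual norm of the eigenfunction over the light cone. -/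
theorem exists_dual_norm_le {N : ℕ} (hN : 1 ≤ N) {m p R : ℝ} (hm : 0 ≤ m) (hp : 1 < p)
    (hR : 0 < R) : ∃ C : ℝ, 0 < C ∧ ∀ s : ℝ, 1 ≤ s →
      (∫ x in Metric.closedBall (0 : Space N) (xi m s + R), eigenfun N x ^ (p / (p - 1))) ^ (p - 1)
        ≤ C * (s ^ ((m + 1) * ((N : ℝ) - 1) * (p / 2 - 1)) * Real.exp (xi m s) ^ p) := by
  have hp1 : 0 < p - 1 := by linarith
  have hp' : 1 < p / (p - 1) := by rw [one_lt_div hp1]; linarith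
  obtain ⟨C, hC0, hC⟩ := exists_integral_eigenfun_rpow_le hN hp'
  set γ : ℝ := ((N : ℝ) - 1) * (1 - p / (p - 1) / 2) with hγ
  set k : ℝ := (1 / (m + 1)) ^ γ + (1 / (m + 1) + 1 + R) ^ γ with hk
  have hk0 : 0 < k := by positivity
  refine ⟨(C * k * Real.exp (p / (p - 1) * R)) ^ (p - 1), by positivity, fun s hs => ?_⟩
  have hs0 : 0 < s := by linarith
  have hxi := xi_nonneg hm hs0.le
  have h1 := hC (xi m s + R) (by linarith)
  have h2 := rpow_le_of_between γ (by positivity) (by positivity)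
    (by positivity : 0 < s ^ (m + 1)) (le_xi_add hR.le) (xi_add_le hm hR.le hs)
  have h3 : ∫ x in Metric.closedBall (0 : Space N) (xi m s + R), eigenfun N x ^ (p / (p - 1))
      ≤ (C * k * Real.exp (p / (p - 1) * R))
        * ((s ^ (m + 1)) ^ γ * Real.exp (p / (p - 1) * xi m s)) := by
    calc _ ≤ _ := h1
      _ ≤ C * ((k * (s ^ (m + 1)) ^ γ) * Real.exp (p / (p - 1) * (xi m s + R))) := by gcongr
      _ = _ := by rw [mul_add, Real.exp_add]; ring
  have h0 : 0 ≤ ∫ x in Metric.closedBall (0 : Space N) (xi m s + R),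
      eigenfun N x ^ (p / (p - 1)) :=
    integral_nonneg fun x => Real.rpow_nonneg (eigenfun_pos hN x).le _
  refine (Real.rpow_le_rpow h0 h3 hp1.le).trans (le_of_eq ?_)
  rw [Real.mul_rpow (by positivity) (by positivity), Real.mul_rpow (x := (s ^ (m + 1)) ^ γ)
    (by positivity) (Real.exp_pos _).le, ← Real.rpow_mul hs0.le, ← Real.rpow_mul hs0.le,
    ← Real.exp_mul, ← Real.exp_mul]
  congr 3
  · rw [hγ]; field_simp
    ring
  · field_simp

/-- Growth in time of the volume of the light cone. -/
theorem exists_volume_le {N : ℕ} {m q R : ℝ} (hm : 0 ≤ m) (hq : 1 < q) (hR : 0 < R) :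
    ∃ C : ℝ, 0 < C ∧ ∀ s : ℝ, 1 ≤ s →
      (volume : Measure (Space N)).real (Metric.closedBall 0 (xi m s + R)) ^ (q - 1)
        ≤ C * s ^ ((m + 1) * N * (q - 1)) := by
  set v : ℝ := (volume : Measure (Space N)).real (Metric.ball 0 1) with hv
  have hv0 : 0 ≤ v := measureReal_nonneg
  have hq1 : 0 < q - 1 := by linarith
  set k : ℝ := 1 / (m + 1) + 1 + R with hk
  have hk0 : 0 < k := by positivity
  refine ⟨(k ^ N * (v + 1)) ^ (q - 1), by positivity, fun s hs => ?_⟩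
  have hs0 : 0 < s := by linarith
  have hxi := xi_nonneg hm hs0.le
  have h1 : (volume : Measure (Space N)).real (Metric.closedBall 0 (xi m s + R))
      = (xi m s + R) ^ N * v := by
    rw [measureReal_def, Measure.addHaar_closedBall _ _ (by linarith), ENNReal.toReal_mul,
      ENNReal.toReal_ofReal (by positivity), finrank_euclideanSpace, Fintype.card_fin, hv,
      measureReal_def]
  have h2 : (xi m s + R) ^ N * v ≤ k ^ N * (v + 1) * (s ^ (m + 1)) ^ N := by
    have h3 : xi m s + R ≤ k * s ^ (m + 1) := by
      have := xi_add_le hm hR.le hs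
      linarith
    calc (xi m s + R) ^ N * v ≤ (k * s ^ (m + 1)) ^ N * (v + 1) := by gcongr; linarith
      _ = _ := by rw [mul_pow]; ring
  rw [h1]
  refine (Real.rpow_le_rpow (by positivity) h2 hq1.le).trans (le_of_eq ?_)
  rw [Real.mul_rpow (by positivity) (by positivity), ← Real.rpow_mul_natCast hs0.le,
    ← Real.rpow_mul hs0.le]

/-- Upper bound for the existence time of solutions of `F'' = n` with `n ≥ a s^β` and
`n ≥ F^q / (C s^d)`. The first inequality makes `F (τ)` at least of the size of `a τ^{β + 2}`,
which is then the initial value for the blow-up on `[τ, 2τ]`. -/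
theorem exists_scalar_lifespan {q β C d t₀ : ℝ} (hq : 1 < q) (hC : 0 < C) (hd : 0 ≤ d)
    (ht₀ : 0 < t₀) :
    ∃ M : ℝ, 0 < M ∧ ∀ (a τ : ℝ) (F W n : ℝ → ℝ), 0 < a → 2 * t₀ ≤ τ →
      (∀ t ∈ Icc 0 (2 * τ), HasDerivWithinAt F (W t) (Icc 0 (2 * τ)) t) →
      (∀ s ∈ Icc 0 (2 * τ), ∀ t ∈ Icc s (2 * τ), IntervalIntegrable n volume s t ∧
        W s + ∫ r in s..t, n r = W t) →
      0 ≤ F 0 → 0 ≤ W 0 → (∀ s, 0 ≤ n s) →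
      (∀ᵐ s ∂(volume.restrict (Ioc 0 (2 * τ))),
        t₀ ≤ s → a * s ^ β ≤ n s ∧ (0 ≤ F s → F s ^ q ≤ n s * (C * s ^ d))) →
      a ^ (q - 1) * τ ^ ((β + 2) * (q - 1) - d + 2) < M := by
  obtain ⟨M, hM0, hM⟩ := exists_blowup_const hq
  -- lower bound of `s ^ β / τ ^ β` on `[τ / 2, τ]`
  set l : ℝ := (1 + (1 / 2) ^ (-β))⁻¹ with hl
  have hl0 : 0 < l := by positivity
  refine ⟨M * (C * 2 ^ d) / (l / 16) ^ (q - 1), by positivity, ?_⟩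
  intro a τ F W n ha hτ hF hW hF0 hW0 hn0 hae
  have hτ0 : 0 < τ := by linarith
  have hWmono : ∀ s ∈ Icc 0 (2 * τ), ∀ t ∈ Icc s (2 * τ), W s ≤ W t := by
    intro s hs t ht
    have := (hW s hs t ht).2
    have : 0 ≤ ∫ r in s..t, n r := intervalIntegral.integral_nonneg ht.1 fun r _ => hn0 r
    linarith
  have hWpos : ∀ s ∈ Icc 0 (2 * τ), 0 ≤ W s := fun s hs =>
    hW0.trans (hWmono 0 ⟨le_rfl, by linarith⟩ s hs)
  have hFmono := monotoneOn_of_hasDerivWithinAt_nonneg hF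
    fun t ht => hWpos t (Ioo_subset_Icc_self ht)
  have hFpos : ∀ s ∈ Icc 0 (2 * τ), 0 ≤ F s := fun s hs =>
    hF0.trans (hFmono ⟨le_rfl, by linarith⟩ hs hs.1)
  have hlower : ∀ s t L : ℝ, 0 < s → s ≤ t → t ≤ 2 * τ →
      (∀ᵐ r ∂(volume.restrict (Icc s t)), L ≤ n r) → W s + L * (t - s) ≤ W t := by
    intro s t L hs hst ht hL
    have h1 := hW s ⟨hs.le, hst.trans ht⟩ t ⟨hst, ht⟩
    have h2 := intervalIntegral.integral_mono_ae_restrict hst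
      (intervalIntegrable_const (c := L)) h1.1 hL
    rw [intervalIntegral.integral_const, smul_eq_mul] at h2
    linarith [h1.2]
  have hae' : ∀ s t : ℝ, 0 < s → t ≤ 2 * τ → ∀ᵐ r ∂(volume.restrict (Icc s t)),
      t₀ ≤ r → a * r ^ β ≤ n r ∧ (0 ≤ F r → F r ^ q ≤ n r * (C * r ^ d)) :=
    fun s t hs ht => ae_restrict_of_ae_restrict_of_subset
      (show Icc s t ⊆ Ioc 0 (2 * τ) from fun r hr => ⟨hs.trans_le hr.1, hr.2.trans ht⟩) hae
  have hlτ : ∀ r ∈ Icc (τ / 2) τ, l * τ ^ β ≤ r ^ β := by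
    intro r hr
    have hr0 : 0 < r := by linarith [hr.1]
    have h := rpow_le_of_between (-β) (k₁ := 1 / 2) (k₂ := 1) (x := r) (by norm_num) (by norm_num)
      hτ0 (by linarith [hr.1]) (by linarith [hr.2])
    rw [Real.one_rpow, add_comm, Real.rpow_neg hr0.le, Real.rpow_neg hτ0.le] at h
    have p1 : 0 < r ^ β := by positivity
    have p2 : 0 < τ ^ β := by positivity
    rw [hl, inv_mul_le_iff₀ (by positivity)]
    have h' := mul_le_mul_of_nonneg_left h (by positivity : 0 ≤ r ^ β * τ ^ β)
    calc τ ^ β = r ^ β * τ ^ β * (r ^ β)⁻¹ := by field_simp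
      _ ≤ _ := h'
      _ = _ := by field_simp
  -- integration of `n ≥ a l τ ^ β` over the quarter `[τ / 2, 3τ / 4]`
  have hWτ : a * (l * τ ^ β) * (τ / 4) ≤ W (3 * τ / 4) := by
    have := hlower (τ / 2) (3 * τ / 4) (a * (l * τ ^ β)) (by positivity) (by linarith)
      (by linarith) (by
        filter_upwards [hae' (τ / 2) (3 * τ / 4) (by positivity) (by linarith),
          ae_restrict_mem measurableSet_Icc] with r hr hrm
        refine le_trans ?_ (hr (by linarith [hrm.1])).1
        have := hlτ r ⟨hrm.1, by linarith [hrm.2]⟩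
        gcongr)
    have hW2 := hWpos (τ / 2) ⟨by positivity, by linarith⟩
    calc _ = a * (l * τ ^ β) * (3 * τ / 4 - τ / 2) := by ring
      _ ≤ _ := by linarith
  set F₀ : ℝ := l / 16 * (a * τ ^ (β + 2)) with hF₀
  have hF₀pos : 0 < F₀ := by positivity
  have hFτ : F₀ ≤ F τ := by
    set w : ℝ := a * (l * τ ^ β) * (τ / 4) with hw
    have hsub : Icc (3 * τ / 4) τ ⊆ Icc 0 (2 * τ) :=
      Icc_subset_Icc (by positivity) (by linarith)
    -- `F' ≥ w` on the remaining quarter `[3τ/4, τ]`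
    have hm := monotoneOn_of_hasDerivWithinAt_nonneg (a := 3 * τ / 4) (b := τ)
      (D := fun t => F t - w * t) (E := fun t => W t - w * 1)
      (fun t ht => ((hF t (hsub ht)).mono hsub).sub
        ((hasDerivAt_id t).const_mul w).hasDerivWithinAt)
      (fun t ht => by
        have := hWmono (3 * τ / 4) (hsub ⟨le_rfl, by linarith⟩) t ⟨ht.1.le, by linarith [ht.2]⟩
        linarith) ⟨le_rfl, by linarith⟩ ⟨by linarith, le_rfl⟩ (by linarith)
    have hF3 := hFpos (3 * τ / 4) ⟨by positivity, by linarith⟩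
    have : τ ^ (β + 2) = τ ^ β * τ ^ 2 := by
      rw [Real.rpow_add hτ0]; norm_cast
    simp only at hm
    rw [hF₀, this]
    have e : l / 16 * (a * (τ ^ β * τ ^ 2)) = w * τ - w * (3 * τ / 4) := by rw [hw]; ring
    linarith
  set K : ℝ := 1 / (C * (2 * τ) ^ d) with hK
  have hK0 : 0 < K := by positivity
  have hsub : Icc τ (2 * τ) ⊆ Icc 0 (2 * τ) := Icc_subset_Icc hτ0.le le_rfl
  have hfin := hM τ K F₀ F W hτ0 hK0 hF₀pos (fun t ht => (hF t (hsub ht)).mono hsub)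
    (fun s hs => hWpos s (hsub hs))
    (fun s hs t ht L hL hLF => hlower s t (K * L ^ q) (by linarith [hs.1]) ht.1 ht.2 (by
      filter_upwards [hae' s t (by linarith [hs.1]) ht.2,
        ae_restrict_mem measurableSet_Icc] with r hr hrm
      have hr0 : 0 < r := by linarith [hs.1, hrm.1]
      have hLr := hLF r hrm
      have h1 := (hr (by linarith [hs.1, hrm.1])).2 (hL.le.trans hLr)
      have h2 : L ^ q ≤ F r ^ q := by gcongr
      have h3 : n r * (C * r ^ d) ≤ n r * (C * (2 * τ) ^ d) := by
        have := hn0 r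
        have : r ≤ 2 * τ := hrm.2.trans ht.2
        gcongr
      rw [hK, one_div_mul_eq_div, div_le_iff₀ (by positivity)]
      linarith)) hFτ
  have e1 : F₀ ^ (q - 1) = (l / 16) ^ (q - 1) * (a ^ (q - 1) * τ ^ ((β + 2) * (q - 1))) := by
    rw [hF₀, Real.mul_rpow (by positivity) (by positivity), Real.mul_rpow ha.le (by positivity),
      ← Real.rpow_mul hτ0.le]
  have e2 : τ ^ ((β + 2) * (q - 1) - d + 2) = τ ^ ((β + 2) * (q - 1)) / τ ^ d * τ ^ 2 := by
    rw [Real.rpow_add hτ0, Real.rpow_sub hτ0]; norm_cast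
  rw [hK, e1, Real.mul_rpow (by norm_num) hτ0.le] at hfin
  rw [lt_div_iff₀ (by positivity), e2]
  have hτd : 0 < τ ^ d := by positivity
  have := mul_lt_mul_of_pos_right hfin (by positivity : 0 < C * 2 ^ d)
  refine lt_of_le_of_lt (le_of_eq ?_) this
  field_simp

end Tricomi
end

theorem mainTheorem1 (N : ℕ) (hN : 1 ≤ N) (m p q R : ℝ) (hm : 0 ≤ m) (hp : 1 < p) (hq : 1 < q)
    (hR : 0 < R)
    (hlam : Tricomi.lam p q N m < 4)
    (hptr : Tricomi.pTr N m < (p : EReal))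
    (hqC : Tricomi.qC N m < q)
    (f g : Tricomi.Space N → ℝ)
    (hf_smooth : ContDiff ℝ ∞ f) (hg_smooth : ContDiff ℝ ∞ g)
    (hf_nonneg : ∀ x, 0 ≤ f x) (hg_nonneg : ∀ x, 0 ≤ g x)
    (hf_supp : tsupport f ⊆ Metric.closedBall 0 R)
    (hg_supp : tsupport g ⊆ Metric.closedBall 0 R)
    (hf_ne : ∃ x, f x ≠ 0) (hg_ne : ∃ x, g x ≠ 0) :
    ∃ ε₀ : ℝ, 0 < ε₀ ∧ ∃ C : ℝ, 0 < C ∧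
      ∀ ε : ℝ, 0 < ε → ε ≤ ε₀ →
        ∀ (T : ℝ≥0∞) (u : ℝ → Tricomi.H1 N),
          Tricomi.IsEnergySolution m p q ε f g T u →
          Tricomi.SupportedInCone m R T u →
          T ≤ ENNReal.ofReal
            (C * ε ^ (-(2 * p * (q - 1) / (4 - Tricomi.lam p q N m)))) := by
  have hpos : ∀ h : Tricomi.Space N → ℝ, ContDiff ℝ ∞ h → (∀ x, 0 ≤ h x) →
      tsupport h ⊆ Metric.closedBall 0 R → (∃ x, h x ≠ 0) →
      0 < ∫ x, h x * Tricomi.eigenfun N x := by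
    intro h hs h0 hsupp ⟨x, hx⟩
    have hc : HasCompactSupport h :=
      (isCompact_closedBall 0 R).of_isClosed_subset (isClosed_tsupport h) hsupp
    exact (hs.continuous.mul (Tricomi.contDiff_eigenfun hN).continuous
      ).integral_pos_of_hasCompactSupport_nonneg_nonzero hc.mul_right
      (fun y => mul_nonneg (h0 y) (Tricomi.eigenfun_pos hN y).le)
      (mul_ne_zero hx (Tricomi.eigenfun_pos hN x).ne')
  set Λ : ℝ := Tricomi.lam p q N m with hΛ
  have hIf := hpos f hf_smooth hf_nonneg hf_supp hf_ne
  have hIg := hpos g hg_smooth hg_nonneg hg_supp hg_ne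
  set A : ℝ := min (∫ x, f x * Tricomi.eigenfun N x) (∫ x, g x * Tricomi.eigenfun N x) with hA
  have hA0 : 0 < A := lt_min hIf hIg
  obtain ⟨t₀, ht₀, c, hc0, hgrow⟩ := Tricomi.exists_exp_growth hm
  obtain ⟨C₁, hC₁0, hC₁⟩ := Tricomi.exists_dual_norm_le hN hm hp hR
  obtain ⟨C₂, hC₂0, hC₂⟩ := Tricomi.exists_volume_le (N := N) hm hq hR
  set β : ℝ := m * p / 2 - (m + 1) * ((N : ℝ) - 1) * (p / 2 - 1) with hβ
  have hq1 : 0 < q - 1 := by linarith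
  have hd : 0 ≤ (m + 1) * N * (q - 1) := by positivity
  set a₀ : ℝ := (c * A) ^ p / C₁ with ha₀
  have ha₀0 : 0 < a₀ := by positivity
  obtain ⟨M, hM0, hM⟩ := Tricomi.exists_scalar_lifespan (β := β) hq hC₂0 hd (by linarith : 0 < t₀)
  set e : ℝ := (β + 2) * (q - 1) - (m + 1) * N * (q - 1) + 2 with he
  have heΛ : 4 - Λ = 2 * e := by rw [he, hβ, hΛ, Tricomi.lam]; ring
  have he0 : 0 < e := by linarith
  have hκ : 2 * p * (q - 1) / (4 - Λ) = p * (q - 1) / e := by rw [heΛ]; field_simp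
  rw [hκ]
  -- the first entry makes `τ / 2 ≥ t₀`, the second one forces blow-up before `2 * τ`
  set D : ℝ := max (2 * t₀) ((M / a₀ ^ (q - 1)) ^ (1 / e)) with hD
  have hD0 : 0 < D := lt_max_of_lt_left (by linarith)
  refine ⟨1, one_pos, 2 * D, by positivity, fun ε hε hε1 T u sol hsupp => ?_⟩
  by_contra! hT
  have hεκ : 1 ≤ ε ^ (-(p * (q - 1) / e)) :=
    Real.one_le_rpow_of_pos_of_le_one_of_nonpos hε hε1
      (neg_nonpos.mpr (by positivity))
  set τ : ℝ := D * ε ^ (-(p * (q - 1) / e)) with hτ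
  rw [mul_assoc, ← hτ] at hT
  have hDτ : D ≤ τ := le_mul_of_one_le_right hD0.le hεκ
  have hτ0 : 0 < τ := hD0.trans_le hDτ
  obtain ⟨U, V, F, W, n, hU, hV, hU0, hV0, hF, hW, hF0, hW0, hn0, hae⟩ :=
    sol.exists_scalar_reduction hN hm hp hq hR hf_supp hg_supp hsupp (by positivity) hT
  have hVlow := hgrow (ε * A) (2 * τ) U V (by positivity) hU hV
    (by rw [hU0]; exact mul_le_mul_of_nonneg_left (min_le_left _ _) hε.le)
    (by rw [hV0]; exact mul_le_mul_of_nonneg_left (min_le_right _ _) hε.le)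
  have hfin := hM (a₀ * ε ^ p) τ F W n (by positivity) ((le_max_left _ _).trans hDτ) hF hW
    (by rw [hF0]; exact mul_nonneg hε.le (integral_nonneg fun x => by simpa using hf_nonneg x))
    (by rw [hW0]; exact mul_nonneg hε.le (integral_nonneg fun x => by simpa using hg_nonneg x))
    hn0 (by
      filter_upwards [hae, ae_restrict_mem measurableSet_Ioc] with s hs hsm hst
      have hs1 : 1 ≤ s := ht₀.trans hst
      have hs0 : 0 < s := by linarith
      refine ⟨?_, fun hFs => (hs.2 hFs).trans
        (mul_le_mul_of_nonneg_left (hC₂ s hs1) (hn0 s))⟩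
      have hVs := hVlow s ⟨hst, hsm.2⟩
      have hV1 := hs.1 (le_trans (by positivity) hVs)
      set X : ℝ := Real.exp (Tricomi.xi m s) with hX
      have hX0 : 0 < X := Real.exp_pos _
      have h1 : (c * (ε * A) * s ^ (m / 2) * X) ^ p ≤ V s ^ p := by gcongr
      have h2 : (c * (ε * A) * s ^ (m / 2) * X) ^ p
          = (c * A) ^ p * ε ^ p * s ^ (m * p / 2) * X ^ p := by
        rw [show c * (ε * A) * s ^ (m / 2) * X = (c * A) * ε * s ^ (m / 2) * X by ring,
          Real.mul_rpow (by positivity) hX0.le, Real.mul_rpow (by positivity) (by positivity),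
          Real.mul_rpow (by positivity) hε.le, ← Real.rpow_mul hs0.le]
        congr 3; ring
      have h3 : (c * A) ^ p * ε ^ p * s ^ (m * p / 2) * X ^ p
          ≤ n s * (C₁ * (s ^ ((m + 1) * ((N : ℝ) - 1) * (p / 2 - 1)) * X ^ p)) := by
        rw [← h2]
        exact h1.trans (hV1.trans (mul_le_mul_of_nonneg_left (hC₁ s hs1) (hn0 s)))
      rw [hβ, Real.rpow_sub hs0, ha₀]
      set Y : ℝ := s ^ ((m + 1) * ((N : ℝ) - 1) * (p / 2 - 1)) with hY
      have hY0 : 0 < Y := by positivity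
      have hXp : 0 < X ^ p := by positivity
      have h4 : (c * A) ^ p * ε ^ p * s ^ (m * p / 2) ≤ n s * (C₁ * Y) :=
        le_of_mul_le_mul_right (by linarith) hXp
      rw [show (c * A) ^ p / C₁ * ε ^ p * (s ^ (m * p / 2) / Y)
        = (c * A) ^ p * ε ^ p * s ^ (m * p / 2) / (C₁ * Y) by field_simp,
        div_le_iff₀ (by positivity)]
      exact h4)
  -- the choice of `D` contradicts the bound on the existence time
  have h1 : τ ^ e = D ^ e * ε ^ (-(p * (q - 1))) := by
    rw [hτ, Real.mul_rpow hD0.le (by positivity), ← Real.rpow_mul hε.le]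
    congr 2
    field_simp
  have h2 : M / a₀ ^ (q - 1) ≤ D ^ e := by
    calc M / a₀ ^ (q - 1) = ((M / a₀ ^ (q - 1)) ^ (1 / e)) ^ e := by
          rw [← Real.rpow_mul (by positivity), one_div_mul_cancel he0.ne', Real.rpow_one]
      _ ≤ D ^ e := Real.rpow_le_rpow (by positivity) (le_max_right _ _) he0.le
  have h3 : (a₀ * ε ^ p) ^ (q - 1) * τ ^ e = a₀ ^ (q - 1) * D ^ e := by
    rw [h1, Real.mul_rpow ha₀0.le (by positivity), ← Real.rpow_mul hε.le]
    have : ε ^ (p * (q - 1)) * ε ^ (-(p * (q - 1))) = 1 := by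
      rw [← Real.rpow_add hε, add_neg_cancel, Real.rpow_zero]
    linear_combination (a₀ ^ (q - 1) * D ^ e) * this
  rw [h3] at hfin
  rw [div_le_iff₀ (by positivity)] at h2
  linarith
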